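/- Let $\mathcal L_{\mathbb N}$ be the language of Peano arithmetic with additional function symbols for (finitely or infinitely many) primitive recursive functions, including the basic syntactic operations on Gödel numbers; each added symbol is given by a primitive recursive derivation whose constituents are also symbols. Let $\mathcal L_{\mathrm{Tr}}$ add a unary predicate $\mathrm{Tr}$, with primitive connectives and quantifiers $\neg,\vee,\wedge,\forall,\exists$ ($\varphi\to\psi$ is $\neg\varphi\vee\psi$, and $\varphi\leftrightarrow\psi$ is $(\varphi\to\psi)\wedge(\psi\to\varphi)$), and let $\mathrm{PAT}$ be Peano arithmetic (with the recursion equations of the function symbols) with induction for all formulas of $\mathcal L_{\mathrm{Tr}}$. $\mathrm{Sent}$ is the set of codes $\#\varphi$ of $\mathcal L_{\mathrm{Tr}}$-sentences, $\ulcorner\varphi\urcorner$ is the numeral of $\#\varphi$, $t^\circ$ is the value of a closed term $t$, $\underset{.}{\neg}$ is the operation (and function symbol) sending a code to the code of the negation, and $X\vDash\varphi$ means $(\mathbb N,X)\vDash\varphi$ classically, with $\mathrm{Tr}$ interpreted by $X$. For $X\subseteq\mathrm{Sent}$ let $\mathrm{CON}(X)$ say that there is no sentence $\varphi$ with $\#\varphi,\#\neg\varphi\in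 X$, and $\mathrm{MXC}(X)$ that $\mathrm{CON}(X)$ and, for every sentence $\varphi$, $\#\varphi\in X$ or $\#\neg\varphi\in X$; let $X^-=\{\#\varphi:\#\neg\varphi\in X\}\cup(\mathbb N\setminus\mathrm{Sent})$. Let $\mathrm{VB}(X)$, $\mathrm{VC}(X)$, $\mathrm{MC}(X)$ be the sets of codes of sentences $\varphi$ such that $X'\vDash\varphi$ for all $X'$ with $X\subseteq X'\subseteq\mathrm{Sent}$ and, respectively, $X'\cap X^-=\varnothing$, $\mathrm{CON}(X')$, $\mathrm{MXC}(X')$. A *$J$ fixed point* ($J\in\{\mathrm{VB},\mathrm{VC},\mathrm{MC}\}$) is a set $S\subseteq\mathrm{Sent}$ with $\mathrm{CON}(S)$ and $S=J(S)$. For a set $X\subseteq\mathbb N$ and a sentence $\psi$, let $\xi^*(\psi,X)$ hold iff one of the following holds: 1. $\psi$ is a true closed equation or a true negated closed equation; 2. $\psi=\varphi\vee\chi$ with $\#\varphi\in X$ or $\#\chi\in X$; or $\psi=\varphi\wedge\chi$ with $\#\varphi,\#\chi\in X$; 3. $\psi=\forall v\varphi$ with $\#\varphi(t/v)\in X$ for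 all closed terms $t$; or $\psi=\exists v\varphi$ with $\#\varphi(t/v)\in X$ for some closed term $t$; 4. $\psi=\mathrm{Tr}\,t$ with $t^\circ\in X$; or $\psi=\neg\mathrm{Tr}\,t$ with $\underset{.}{\neg}t^\circ\in X$ or $t^\circ\notin\mathrm{Sent}$; 5. $\#\psi=t^\circ$ for some closed term $t$ with $\#\mathrm{Tr}\,t\in X$; or $\psi=\neg\varphi$ and $\#\varphi=t^\circ$ for some closed term $t$ with $\#\neg\mathrm{Tr}\,t\in X$. Let $\Theta^*(S)=\{\#\varphi:\ \mathrm{PAT}\vdash\psi\to\varphi\text{ for some sentence }\psi\text{ with }\xi^*(\psi,S)\}$. The operator $\Theta^*_{\mathrm c}$ is defined in the same way, but $\psi$ may also be any sentence $\neg(\mathrm{Tr}\,s\wedge\mathrm{Tr}\,\underset{.}{\neg}t)$ with $s,t$ closed terms, $s^\circ=t^\circ$; for $\Theta^*_{\mathrm{mc}}$, $\psi$ may also be any sentence $\neg\mathrm{Tr}\,s\leftrightarrow\mathrm{Tr}\,\underset{.}{\neg}t$ with $s,t$ closed terms, $s^\circ=t^\circ\in\mathrm{Sent}$. A set $S$ is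 *classically sound* iff $S\vDash\varphi$ for every sentence $\varphi$ with $\#\varphi\in S$. Put $$\mathcal Z=\{S: S=\Theta^*(S),\ S\text{ classically sound}\},\quad \mathcal Z_{\mathrm c}=\{S: S=\Theta^*_{\mathrm c}(S),\ S\text{ classically sound}\},\quad \mathcal Z_{\mathrm{mc}}=\{S: S=\Theta^*_{\mathrm{mc}}(S),\ \mathrm{CON}(S)\}.$$ The *$\Phi$-closure* of $X$ is $\bigcup_{\alpha\in\mathrm{On}}\Gamma_\alpha$, where $\Gamma_0=X$, $\Gamma_{\alpha+1}=\Phi(\Gamma_\alpha)$ and $\Gamma_\lambda=\bigcup_{\beta<\lambda}\Gamma_\beta$ for limit $\lambda$. A *truth-teller* is a sentence $\tau$ with $\mathrm{PAT}\vdash\tau\leftrightarrow\mathrm{Tr}\ulcorner\tau\urcorner$; a *Liar* is a sentence $\lambda$ with $\mathrm{PAT}\vdash\lambda\leftrightarrow\neg\mathrm{Tr}\ulcorner\lambda\urcorner$. **Proposition.** There are two distinct truth-tellers and two distinct Liars, and the following hold. (VB) Every $\mathrm{VB}$ fixed point belongs to $\mathcal Z$, but $\mathcal Z\neq\{S: S\text{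 is a }\mathrm{VB}\text{ fixed point}\}$. For all distinct truth-tellers $\tau_1,\tau_2$, the $\Theta^*$-closure $Y$ of $\{\#(\neg\tau_1\vee\neg\tau_2)\}$ satisfies $Y\in\mathcal Z$ and $Y\neq\mathrm{VB}(Y)$. (VC) Every $\mathrm{VC}$ fixed point belongs to $\mathcal Z_{\mathrm c}$, but $\mathcal Z_{\mathrm c}\neq\{S: S\text{ is a }\mathrm{VC}\text{ fixed point}\}$. For all distinct truth-tellers $\tau_1,\tau_2$, the $\Theta^*_{\mathrm c}$-closure $Y$ of $\{\#(\neg\tau_1\vee\neg\tau_2)\}$ satisfies $Y\in\mathcal Z_{\mathrm c}$ and $Y\neq\mathrm{VC}(Y)$. (MC) Every $\mathrm{MC}$ fixed point belongs to $\mathcal Z_{\mathrm{mc}}$, but $\mathcal Z_{\mathrm{mc}}\neq\{S: S\text{ is an }\mathrm{MC}\text{ fixed point}\}$. For all distinct Liars $\lambda_1,\lambda_2$, the $\Theta^*_{\mathrm{mc}}$-closure $Y$ of $\{\#(\lambda_1\leftrightarrow\lambda_2)\}$ satisfies $Y\in\mathcal Z_{\mathrm{mc}}$ and $Y\neq\mathrm{MC}(Y)$.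 -/

import Mathlib

namespace SupTruth

/-! ## Primitive recursive function symbols -/

/-- Derivations of primitive recursive functions; they serve as function symbols. -/
inductive PR : ℕ → Type
  | zero : PR 0
  | succ : PR 1
  | proj {k : ℕ} (i : Fin k) : PR k
  | comp {m k : ℕ} (f : PR m) (g : Fin m → PR k) : PR k
  | prec {k : ℕ} (f : PR k) (g : PR (k + 2)) : PR (k + 1)

/-- The function denoted by a symbol. In `prec` the recursion argument is the first one. -/
def PR.eval : {k : ℕ} → PR k → (Fin k → ℕ) → ℕ
  | _, .zero, _ => 0
  | _, .succ, v => v 0 + 1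
  | _, .proj i, v => v i
  | _, .comp f g, v => f.eval (fun i => (g i).eval v)
  | _, .prec f g, v =>
      Nat.rec (f.eval (Fin.tail v)) (fun y ih => g.eval (Fin.cons y (Fin.cons ih (Fin.tail v)))) (v 0)

/-! ## Operations on Gödel numbers -/

/-- Code of a tuple of known length. -/
def tupleCode : {k : ℕ} → (Fin k → ℕ) → ℕ
  | 0, _ => 0
  | _ + 1, v => Nat.pair (v 0) (tupleCode (Fin.tail v))

def PR.code : {k : ℕ} → PR k → ℕ
  | _, .zero => Nat.pair 0 0
  | _, .succ => Nat.pair 1 0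
  | _, .proj i => Nat.pair 2 i
  | _, .comp (m := m) f g => Nat.pair 3 (Nat.pair m (Nat.pair f.code (tupleCode fun i => (g i).code)))
  | _, .prec f g => Nat.pair 4 (Nat.pair f.code g.code)

def eqCode (s t : ℕ) : ℕ := Nat.pair 0 (Nat.pair s t)
def trCode (t : ℕ) : ℕ := Nat.pair 1 t
def negCode (x : ℕ) : ℕ := Nat.pair 2 x
def orCode (x y : ℕ) : ℕ := Nat.pair 3 (Nat.pair x y)
def andCode (x y : ℕ) : ℕ := Nat.pair 4 (Nat.pair x y)
def allCode (x : ℕ) : ℕ := Nat.pair 5 x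
def exCode (x : ℕ) : ℕ := Nat.pair 6 x
/-- The code of the numeral of `x`. -/
def numCode (x : ℕ) : ℕ := Nat.rec (Nat.pair 1 0) (fun _ c => Nat.pair 2 c) x

/-! ## Language -/

/-- A choice of base language: besides `0, S, +, ·` it has the function symbols in `sym`, each given
by a primitive recursive derivation whose constituents are symbols too (so that the recursion
equations can be stated), among them symbols for the basic operations on Gödel numbers. Any family
of symbols, finite or infinite, with these properties is allowed. -/
structure ArithLang where
  sym : ∀ {k : ℕ}, PR k → Prop
  sym_comp : ∀ {m k : ℕ} (f : PR m) (g : Fin m → PR k), sym (.comp f g) → sym f ∧ ∀ i, sym (g i)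
  sym_prec : ∀ {k : ℕ} (f : PR k) (g : PR (k + 2)), sym (.prec f g) → sym f ∧ sym g
  eqSym : PR 2
  eqSym_mem : sym eqSym
  eqSym_eval : ∀ x y, eqSym.eval ![x, y] = eqCode x y
  trSym : PR 1
  trSym_mem : sym trSym
  trSym_eval : ∀ x, trSym.eval ![x] = trCode x
  negSym : PR 1
  negSym_mem : sym negSym
  negSym_eval : ∀ x, negSym.eval ![x] = negCode x
  orSym : PR 2
  orSym_mem : sym orSym
  orSym_eval : ∀ x y, orSym.eval ![x, y] = orCode x y
  andSym : PR 2
  andSym_mem : sym andSym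
  andSym_eval : ∀ x y, andSym.eval ![x, y] = andCode x y
  allSym : PR 1
  allSym_mem : sym allSym
  allSym_eval : ∀ x, allSym.eval ![x] = allCode x
  exSym : PR 1
  exSym_mem : sym exSym
  exSym_eval : ∀ x, exSym.eval ![x] = exCode x
  numSym : PR 1
  numSym_mem : sym numSym
  numSym_eval : ∀ x, numSym.eval ![x] = numCode x

/-- Every primitive recursive function has a derivation. -/
theorem exists_PR {k : ℕ} {f : List.Vector ℕ k → ℕ} (hf : Nat.Primrec' f) :
    ∃ p : PR k, ∀ v, p.eval v = f (List.Vector.ofFn v) := by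
  induction hf with
  | zero => exact ⟨.zero, fun v => rfl⟩
  | succ => exact ⟨.succ, fun v => rfl⟩
  | get i => exact ⟨.proj i, fun v => by simp [PR.eval]⟩
  | comp g _ _ ihf ihg =>
    obtain ⟨p, hp⟩ := ihf
    choose q hq using ihg
    exact ⟨.comp p q, fun v => by simp [PR.eval, hp, hq]⟩
  | prec _ _ ihf ihg =>
    obtain ⟨p, hp⟩ := ihf
    obtain ⟨q, hq⟩ := ihg
    refine ⟨.prec p q, fun v => ?_⟩
    simp only [PR.eval, hp, hq]
    rfl

/-- There are such languages. -/
theorem ArithLang.nonempty : Nonempty ArithLang := by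
  have h1 : ∀ f : ℕ → ℕ, Primrec f → ∃ p : PR 1, ∀ x, p.eval ![x] = f x := fun f hf => by
    obtain ⟨p, hp⟩ := exists_PR (Nat.Primrec'.of_prim (f := fun v : List.Vector ℕ 1 => f v.head)
      (hf.comp Primrec.vector_head))
    exact ⟨p, fun x => by rw [hp]; rfl⟩
  have h2 : ∀ f : ℕ → ℕ → ℕ, Primrec₂ f → ∃ p : PR 2, ∀ x y, p.eval ![x, y] = f x y :=
    fun f hf => by
      obtain ⟨p, hp⟩ := exists_PR (Nat.Primrec'.of_prim
        (f := fun v : List.Vector ℕ 2 => f v.head v.tail.head)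
        (hf.comp Primrec.vector_head (Primrec.vector_head.comp Primrec.vector_tail)))
      exact ⟨p, fun x y => by rw [hp]; rfl⟩
  have q1 : ∀ c, Primrec (fun x => Nat.pair c x) := fun c =>
    Primrec₂.natPair.comp (Primrec.const c) Primrec.id
  have q2 : ∀ c, Primrec₂ (fun x y => Nat.pair c (Nat.pair x y)) := fun c =>
    Primrec₂.natPair.comp (Primrec.const c) Primrec₂.natPair
  obtain ⟨a0, e0⟩ := h2 _ (q2 0)
  obtain ⟨a1, e1⟩ := h1 _ (q1 1)
  obtain ⟨a2, e2⟩ := h1 _ (q1 2)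
  obtain ⟨a3, e3⟩ := h2 _ (q2 3)
  obtain ⟨a4, e4⟩ := h2 _ (q2 4)
  obtain ⟨a5, e5⟩ := h1 _ (q1 5)
  obtain ⟨a6, e6⟩ := h1 _ (q1 6)
  obtain ⟨a7, e7⟩ := h1 numCode
    (Primrec.nat_rec₁ (Nat.pair 1 0) (Primrec.comp (q1 2) Primrec.snd).to₂)
  exact ⟨⟨fun _ => True, fun _ _ _ => ⟨trivial, fun _ => trivial⟩, fun _ _ _ => ⟨trivial, trivial⟩,
    a0, trivial, e0, a1, trivial, e1, a2, trivial, e2, a3, trivial, e3, a4, trivial, e4,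
    a5, trivial, e5, a6, trivial, e6, a7, trivial, e7⟩⟩

/-- Terms with free variables among `0, …, n - 1`. -/
inductive Term (L : ArithLang) (n : ℕ) : Type
  | var (i : Fin n) : Term L n
  | zero : Term L n
  | succ (t : Term L n) : Term L n
  | add (s t : Term L n) : Term L n
  | mul (s t : Term L n) : Term L n
  | fn {k : ℕ} (f : PR k) (hf : L.sym f) (ts : Fin k → Term L n) : Term L n

/-- Formulas of the language with the truth predicate, with free variables among `0, …, n - 1`
(de Bruijn indices: a quantifier binds variable `0` and shifts the others). -/
inductive Fml (L : ArithLang) : ℕ → Type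
  | eq {n : ℕ} (s t : Term L n) : Fml L n
  | tr {n : ℕ} (t : Term L n) : Fml L n
  | neg {n : ℕ} (φ : Fml L n) : Fml L n
  | or {n : ℕ} (φ ψ : Fml L n) : Fml L n
  | and {n : ℕ} (φ ψ : Fml L n) : Fml L n
  | all {n : ℕ} (φ : Fml L (n + 1)) : Fml L n
  | ex {n : ℕ} (φ : Fml L (n + 1)) : Fml L n

variable {L : ArithLang}

abbrev CTerm (L : ArithLang) : Type := Term L 0
abbrev Sentence (L : ArithLang) : Type := Fml L 0

def Fml.imp {n : ℕ} (φ ψ : Fml L n) : Fml L n := .or (.neg φ) ψ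
def Fml.iff {n : ℕ} (φ ψ : Fml L n) : Fml L n := .and (φ.imp ψ) (ψ.imp φ)

def Term.subst {n m : ℕ} (σ : Fin n → Term L m) : Term L n → Term L m
  | .var i => σ i
  | .zero => .zero
  | .succ t => .succ (t.subst σ)
  | .add s t => .add (s.subst σ) (t.subst σ)
  | .mul s t => .mul (s.subst σ) (t.subst σ)
  | .fn f hf ts => .fn f hf (fun i => (ts i).subst σ)

/-- The substitution that acts as `σ` below a quantifier. -/
def liftSubst {n m : ℕ} (σ : Fin n → Term L m) : Fin (n + 1) → Term L (m + 1) :=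
  Fin.cases (.var 0) (fun i => (σ i).subst (fun j => .var j.succ))

def Fml.subst : {n m : ℕ} → (Fin n → Term L m) → Fml L n → Fml L m
  | _, _, σ, .eq s t => .eq (s.subst σ) (t.subst σ)
  | _, _, σ, .tr t => .tr (t.subst σ)
  | _, _, σ, .neg φ => .neg (φ.subst σ)
  | _, _, σ, .or φ ψ => .or (φ.subst σ) (ψ.subst σ)
  | _, _, σ, .and φ ψ => .and (φ.subst σ) (ψ.subst σ)
  | _, _, σ, .all φ => .all (φ.subst (liftSubst σ))
  | _, _, σ, .ex φ => .ex (φ.subst (liftSubst σ))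

/-- `φ(t)`: substitute `t` for variable `0`, lowering the other variables. -/
def Fml.inst {n : ℕ} (φ : Fml L (n + 1)) (t : Term L n) : Fml L n :=
  φ.subst (Fin.cases t Term.var)

/-- `φ(S x)` for `φ = φ(x)`, `x` being variable `0`. -/
def Fml.instSucc {n : ℕ} (φ : Fml L (n + 1)) : Fml L (n + 1) :=
  φ.subst (Fin.cases (.succ (.var 0)) (fun i => .var i.succ))

/-- `φ` with one more (unused) variable. -/
def Fml.shift {n : ℕ} (φ : Fml L n) : Fml L (n + 1) := φ.subst (fun i => .var i.succ)

/-- Numerals. -/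
def num {n : ℕ} : ℕ → Term L n
  | 0 => .zero
  | k + 1 => .succ (num k)

/-! ## Gödel numbering -/

def Term.code {n : ℕ} : Term L n → ℕ
  | .var i => Nat.pair 0 i
  | .zero => Nat.pair 1 0
  | .succ t => Nat.pair 2 t.code
  | .add s t => Nat.pair 3 (Nat.pair s.code t.code)
  | .mul s t => Nat.pair 4 (Nat.pair s.code t.code)
  | .fn (k := k) f _ ts => Nat.pair 5 (Nat.pair k (Nat.pair f.code (tupleCode fun i => (ts i).code)))

/-- `#φ`. -/
def Fml.code : {n : ℕ} → Fml L n → ℕ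
  | _, .eq s t => eqCode s.code t.code
  | _, .tr t => trCode t.code
  | _, .neg φ => negCode φ.code
  | _, .or φ ψ => orCode φ.code ψ.code
  | _, .and φ ψ => andCode φ.code ψ.code
  | _, .all φ => allCode φ.code
  | _, .ex φ => exCode φ.code

/-- The set of codes of sentences. -/
def Sent (L : ArithLang) : Set ℕ := {n | ∃ φ : Sentence L, φ.code = n}

/-- `⌜φ⌝`, the numeral of `#φ`. -/
def Fml.quote (φ : Sentence L) : CTerm L := num φ.code

/-! ## Classical satisfaction over the standard model -/

def Term.eval {n : ℕ} (e : Fin n → ℕ) : Term L n → ℕ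
  | .var i => e i
  | .zero => 0
  | .succ t => t.eval e + 1
  | .add s t => s.eval e + t.eval e
  | .mul s t => s.eval e * t.eval e
  | .fn f _ ts => f.eval (fun i => (ts i).eval e)

/-- `(ℕ, X) ⊨ φ[e]`, the truth predicate being interpreted by `X`. -/
def Fml.Sat (X : Set ℕ) : {n : ℕ} → (Fin n → ℕ) → Fml L n → Prop
  | _, e, .eq s t => s.eval e = t.eval e
  | _, e, .tr t => t.eval e ∈ X
  | _, e, .neg φ => ¬ φ.Sat X e
  | _, e, .or φ ψ => φ.Sat X e ∨ ψ.Sat X e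
  | _, e, .and φ ψ => φ.Sat X e ∧ ψ.Sat X e
  | _, e, .all φ => ∀ a : ℕ, φ.Sat X (Fin.cases a e)
  | _, e, .ex φ => ∃ a : ℕ, φ.Sat X (Fin.cases a e)

/-- `X ⊨ φ`. -/
def Models (X : Set ℕ) (φ : Sentence L) : Prop := φ.Sat X Fin.elim0

/-- `t°`, the value of a closed term. -/
def Term.val (t : CTerm L) : ℕ := t.eval Fin.elim0

/-! ## The theory PAT -/

/-- Axioms of `PAT` (free variables are read universally): Peano arithmetic with the recursion
equations of the function symbols, and induction for all formulas of the language with the truth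
predicate. -/
inductive PATAxiom : {n : ℕ} → Fml L n → Prop
  | succ_ne_zero {n : ℕ} (t : Term L n) : PATAxiom (.neg (.eq (.succ t) .zero))
  | succ_inj {n : ℕ} (s t : Term L n) :
      PATAxiom (Fml.imp (.eq (.succ s) (.succ t)) (.eq s t))
  | add_zero {n : ℕ} (t : Term L n) : PATAxiom (.eq (.add t .zero) t)
  | add_succ {n : ℕ} (s t : Term L n) :
      PATAxiom (.eq (.add s (.succ t)) (.succ (.add s t)))
  | mul_zero {n : ℕ} (t : Term L n) : PATAxiom (.eq (.mul t .zero) .zero)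
  | mul_succ {n : ℕ} (s t : Term L n) :
      PATAxiom (.eq (.mul s (.succ t)) (.add (.mul s t) s))
  | induction {n : ℕ} (φ : Fml L (n + 1)) :
      PATAxiom (Fml.imp (.and (φ.inst .zero) (.all (φ.imp φ.instSucc))) (.all φ))
  | fn_zero {n : ℕ} (h : L.sym .zero) (ts : Fin 0 → Term L n) :
      PATAxiom (.eq (.fn .zero h ts) .zero)
  | fn_succ {n : ℕ} (h : L.sym .succ) (ts : Fin 1 → Term L n) :
      PATAxiom (.eq (.fn .succ h ts) (.succ (ts 0)))
  | fn_proj {n k : ℕ} (i : Fin k) (h : L.sym (.proj i)) (ts : Fin k → Term L n) :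
      PATAxiom (.eq (.fn (.proj i) h ts) (ts i))
  | fn_comp {n m k : ℕ} (f : PR m) (g : Fin m → PR k) (h : L.sym (.comp f g))
      (ts : Fin k → Term L n) :
      PATAxiom (.eq (.fn (.comp f g) h ts)
        (.fn f (L.sym_comp f g h).1 (fun i => .fn (g i) ((L.sym_comp f g h).2 i) ts)))
  | fn_prec_zero {n k : ℕ} (f : PR k) (g : PR (k + 2)) (h : L.sym (.prec f g))
      (ts : Fin k → Term L n) :
      PATAxiom (.eq (.fn (.prec f g) h (Fin.cons .zero ts)) (.fn f (L.sym_prec f g h).1 ts))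
  | fn_prec_succ {n k : ℕ} (f : PR k) (g : PR (k + 2)) (h : L.sym (.prec f g)) (t : Term L n)
      (ts : Fin k → Term L n) :
      PATAxiom (.eq (.fn (.prec f g) h (Fin.cons (.succ t) ts))
        (.fn g (L.sym_prec f g h).2
          (Fin.cons t (Fin.cons (.fn (.prec f g) h (Fin.cons t ts)) ts))))

/-- Derivability from `PAT` and finitely many assumptions: natural deduction for classical
first-order logic with equality. -/
inductive Derives : {n : ℕ} → List (Fml L n) → Fml L n → Prop
  | ax {n : ℕ} {Γ : List (Fml L n)} {φ : Fml L n} : PATAxiom φ → Derives Γ φ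
  | hyp {n : ℕ} {Γ : List (Fml L n)} {φ : Fml L n} : φ ∈ Γ → Derives Γ φ
  | negI {n : ℕ} {Γ : List (Fml L n)} {φ ψ : Fml L n} :
      Derives (φ :: Γ) ψ → Derives (φ :: Γ) (.neg ψ) → Derives Γ (.neg φ)
  | raa {n : ℕ} {Γ : List (Fml L n)} {φ ψ : Fml L n} :
      Derives (.neg φ :: Γ) ψ → Derives (.neg φ :: Γ) (.neg ψ) → Derives Γ φ
  | andI {n : ℕ} {Γ : List (Fml L n)} {φ ψ : Fml L n} :
      Derives Γ φ → Derives Γ ψ → Derives Γ (.and φ ψ)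
  | andE₁ {n : ℕ} {Γ : List (Fml L n)} {φ ψ : Fml L n} : Derives Γ (.and φ ψ) → Derives Γ φ
  | andE₂ {n : ℕ} {Γ : List (Fml L n)} {φ ψ : Fml L n} : Derives Γ (.and φ ψ) → Derives Γ ψ
  | orI₁ {n : ℕ} {Γ : List (Fml L n)} {φ ψ : Fml L n} : Derives Γ φ → Derives Γ (.or φ ψ)
  | orI₂ {n : ℕ} {Γ : List (Fml L n)} {φ ψ : Fml L n} : Derives Γ ψ → Derives Γ (.or φ ψ)
  | orE {n : ℕ} {Γ : List (Fml L n)} {φ ψ χ : Fml L n} :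
      Derives Γ (.or φ ψ) → Derives (φ :: Γ) χ → Derives (ψ :: Γ) χ → Derives Γ χ
  | allI {n : ℕ} {Γ : List (Fml L n)} {φ : Fml L (n + 1)} :
      Derives (Γ.map Fml.shift) φ → Derives Γ (.all φ)
  | allE {n : ℕ} {Γ : List (Fml L n)} {φ : Fml L (n + 1)} (t : Term L n) :
      Derives Γ (.all φ) → Derives Γ (φ.inst t)
  | exI {n : ℕ} {Γ : List (Fml L n)} {φ : Fml L (n + 1)} (t : Term L n) :
      Derives Γ (φ.inst t) → Derives Γ (.ex φ)
  | exE {n : ℕ} {Γ : List (Fml L n)} {φ : Fml L (n + 1)} {χ : Fml L n} :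
      Derives Γ (.ex φ) → Derives (φ :: Γ.map Fml.shift) χ.shift → Derives Γ χ
  | eqI {n : ℕ} {Γ : List (Fml L n)} (t : Term L n) : Derives Γ (.eq t t)
  | eqE {n : ℕ} {Γ : List (Fml L n)} (φ : Fml L (n + 1)) {s t : Term L n} :
      Derives Γ (.eq s t) → Derives Γ (φ.inst s) → Derives Γ (φ.inst t)

/-- `PAT ⊢ φ`. -/
def Provable (φ : Sentence L) : Prop := Derives [] φ

def IsTruthTeller (τ : Sentence L) : Prop := Provable (τ.iff (.tr τ.quote))

def IsLiar (l : Sentence L) : Prop := Provable (l.iff (.neg (.tr l.quote)))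

/-! ## Supervaluational jumps -/

variable (L) in
/-- No sentence belongs to `X` together with its negation. -/
def CON (X : Set ℕ) : Prop := ¬ ∃ φ : Sentence L, φ.code ∈ X ∧ φ.neg.code ∈ X

variable (L) in
/-- Consistent and complete. -/
def MXC (X : Set ℕ) : Prop := CON L X ∧ ∀ φ : Sentence L, φ.code ∉ X → φ.neg.code ∈ X

variable (L) in
/-- `X⁻`. -/
def antiExt (X : Set ℕ) : Set ℕ := {n | ∃ φ : Sentence L, φ.code = n ∧ φ.neg.code ∈ X} ∪ (Sent L)ᶜ

variable (L) in
def VB (X : Set ℕ) : Set ℕ :=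
  {n | ∃ φ : Sentence L, φ.code = n ∧
    ∀ X' ⊆ Sent L, X ⊆ X' → X' ∩ antiExt L X = ∅ → Models X' φ}

variable (L) in
def VC (X : Set ℕ) : Set ℕ :=
  {n | ∃ φ : Sentence L, φ.code = n ∧ ∀ X' ⊆ Sent L, X ⊆ X' → CON L X' → Models X' φ}

variable (L) in
def MC (X : Set ℕ) : Set ℕ :=
  {n | ∃ φ : Sentence L, φ.code = n ∧ ∀ X' ⊆ Sent L, X ⊆ X' → MXC L X' → Models X' φ}

/-- Fixed points of a supervaluational jump. The jumps are only considered on consistent sets of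
sentences. -/
def SupFixedPoints (L : ArithLang) (J : Set ℕ → Set ℕ) : Set (Set ℕ) :=
  {S | S ⊆ Sent L ∧ CON L S ∧ S = J S}

/-! ## The operators `Θ*`, `Θ*_c`, `Θ*_mc` -/

/-- `ξ*(#φ, X)`. -/
inductive XiStar (X : Set ℕ) : Sentence L → Prop
  | eq (s t : CTerm L) : s.val = t.val → XiStar X (.eq s t)
  | ne (s t : CTerm L) : s.val ≠ t.val → XiStar X (.neg (.eq s t))
  | or (φ ψ : Sentence L) : φ.code ∈ X ∨ ψ.code ∈ X → XiStar X (.or φ ψ)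
  | and (φ ψ : Sentence L) : φ.code ∈ X ∧ ψ.code ∈ X → XiStar X (.and φ ψ)
  | all (φ : Fml L 1) : (∀ t : CTerm L, (φ.inst t).code ∈ X) → XiStar X (.all φ)
  | ex (φ : Fml L 1) : (∃ t : CTerm L, (φ.inst t).code ∈ X) → XiStar X (.ex φ)
  | tr (t : CTerm L) : t.val ∈ X → XiStar X (.tr t)
  | negTr (t : CTerm L) : negCode t.val ∈ X ∨ t.val ∉ Sent L → XiStar X (.neg (.tr t))
  | trElim (φ : Sentence L) (t : CTerm L) :
      φ.code = t.val → (Fml.tr t).code ∈ X → XiStar X φ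
  | negTrElim (φ : Sentence L) (t : CTerm L) :
      φ.code = t.val → (Fml.neg (.tr t)).code ∈ X → XiStar X (.neg φ)

/-- The term `¬. t`. -/
def negTerm (t : CTerm L) : CTerm L := .fn L.negSym L.negSym_mem ![t]

/-- The sentences `¬(Tr s ∧ Tr (¬. t))` with `s° = t°`. -/
def IsCon (φ : Sentence L) : Prop :=
  ∃ s t : CTerm L, s.val = t.val ∧ φ = .neg (.and (.tr s) (.tr (negTerm t)))

/-- The sentences `¬Tr s ↔ Tr (¬. t)` with `s° = t°` the code of a sentence. -/
def IsCom (φ : Sentence L) : Prop :=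
  ∃ s t : CTerm L, s.val = t.val ∧ s.val ∈ Sent L ∧
    φ = Fml.iff (.neg (.tr s)) (.tr (negTerm t))

variable (L) in
def ThetaStar (S : Set ℕ) : Set ℕ :=
  {n | ∃ φ : Sentence L, φ.code = n ∧
    ∃ ψ : Sentence L, XiStar S ψ ∧ Provable (ψ.imp φ)}

variable (L) in
def ThetaStarC (S : Set ℕ) : Set ℕ :=
  {n | ∃ φ : Sentence L, φ.code = n ∧
    ∃ ψ : Sentence L, (XiStar S ψ ∨ IsCon ψ) ∧ Provable (ψ.imp φ)}

variable (L) in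
def ThetaStarMC (S : Set ℕ) : Set ℕ :=
  {n | ∃ φ : Sentence L, φ.code = n ∧
    ∃ ψ : Sentence L, (XiStar S ψ ∨ IsCom ψ) ∧ Provable (ψ.imp φ)}

variable (L) in
def ClassicallySound (S : Set ℕ) : Prop := ∀ φ : Sentence L, φ.code ∈ S → Models S φ

/-- The classically sound fixed points of `Θ*`. -/
def Z (L : ArithLang) : Set (Set ℕ) := {S | S = ThetaStar L S ∧ ClassicallySound L S}

/-- The classically sound fixed points of `Θ*_c`. -/
def Zc (L : ArithLang) : Set (Set ℕ) := {S | S = ThetaStarC L S ∧ ClassicallySound L S}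

/-- The consistent fixed points of `Θ*_mc`. -/
def Zmc (L : ArithLang) : Set (Set ℕ) := {S | S = ThetaStarMC L S ∧ CON L S}

/-! ## Transfinite iteration -/

/-- `Γ_0 = X`, `Γ_{α+1} = Φ(Γ_α)`, `Γ_λ = ⋃_{β<λ} Γ_β`. -/
noncomputable def stage (Φ : Set ℕ → Set ℕ) (X : Set ℕ) (α : Ordinal.{0}) : Set ℕ :=
  Ordinal.limitRecOn α X (fun _ Y => Φ Y) (fun o _ ih => ⋃ β : Set.Iio o, ih β.1 β.2)

/-- `⋃_α Γ_α`. -/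
noncomputable def closureUnder (Φ : Set ℕ → Set ℕ) (X : Set ℕ) : Set ℕ :=
  ⋃ α : Ordinal.{0}, stage Φ X α

end SupTruth

open SupTruth

/-!
The existence of two truth-tellers and two Liars is a diagonal argument. The language has no
symbol for substitution, but the code of `∃ x (x = e ∧ φ(x))` is a value of the available symbols
at the code `e` of `φ`, and the recursion equations let PAT compute these symbols at numerals
(`Derives.fn_num`), so `∃ x (x = e ∧ φ(x))` serves as the diagonal sentence (`diagSentence`).

The rest is semantic: PAT is used through its soundness in every `(ℕ, X)` (`Derives.sat`). Write
`supTruths L F` for the sentences true in `(ℕ, X)` for all `X` in a family `F`; each of the three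
supervaluational jumps has the form `S ↦ supTruths L (F S)`. The families `F S` concerned contain,
when `S ⊆ supTruths L (F S)`, with each `X` also the theory of `(ℕ, X)`. A sentence whose code
lies in the theory of `(ℕ, X)` is true in `(ℕ, X)`, and this justifies the elimination clauses for
the truth predicate; so `S ⊆ supTruths L (F S)` implies `Θ*(S) ⊆ supTruths L (F S)`
(`thetaWith_subset_supTruths`). Since `S ⊆ Θ*(S)` for every set `S` of sentences, a fixed point of
a jump is a fixed point of the corresponding operator.

The same lemma may be applied to smaller families than those of the jumps, and this is what
separates the operators from the jumps. Let `Y` be the closure of `¬τ₁ ∨ ¬τ₂`. Every stage `S` of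
the iteration satisfies `S ⊆ supTruths L (F S)` where `F S` consists of those admissible `X` that
do not contain both truth-tellers, since these make `¬τ₁ ∨ ¬τ₂` true. If `Y` is consistent and
omits a truth-teller, then `Y ∈ F Y`, and `Y` is sound. Both conditions follow from the existence
of maximal consistent extensions of `Y` that contain one truth-teller and omit the other; they are
obtained along the iteration, with an ultralimit at limit stages (`IsClosedClass.closureUnder`).
But the jump at `Y` also admits `Y ∪ {τ₁, τ₂}`, in which `¬τ₁ ∨ ¬τ₂` is false.

For the Liars the class consists of the maximal consistent `X` that contain both Liars or neither.
The closure `Y` of `l₁ ↔ l₂` thus has an extension in this class. No sentence in `Y` differs from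
a Liar in the number of leading negations only, so membership of the Liars in such an extension
can be changed at will (`flipped`), maximal consistency being a condition on pairs `φ, ¬φ` only.
-/


namespace SupTruth

variable {L : ArithLang}

/-! ### Gödel numbering is injective -/

theorem tupleCode_injective : ∀ {k : ℕ}, Function.Injective (tupleCode (k := k))
  | 0, _, _, _ => Subsingleton.elim _ _
  | k + 1, v, w, h => by
    simp only [tupleCode, Nat.pair_eq_pair] at h
    have ht := tupleCode_injective h.2
    rw [← Fin.cons_self_tail v, ← Fin.cons_self_tail w, h.1, ht]

theorem PR.code_injective : ∀ {k : ℕ} (f g : PR k), f.code = g.code → f = g := by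
  intro k f
  induction f with
  | zero => intro g h; cases g <;> simp_all [PR.code, Nat.pair_eq_pair]
  | succ => intro g h; cases g <;> simp_all [PR.code, Nat.pair_eq_pair]
  | proj i => intro g h; cases g <;> simp_all [PR.code, Nat.pair_eq_pair, Fin.ext_iff]
  | @comp m k f g ihf ihg =>
    intro q h
    cases q with
    | @comp m' _ f' g' =>
      simp only [PR.code, Nat.pair_eq_pair, true_and] at h
      obtain ⟨rfl, hf, hg⟩ := h
      rw [ihf _ hf, funext fun i => ihg i _ (congrFun (tupleCode_injective hg) i)]
    | _ => simp_all [PR.code, Nat.pair_eq_pair]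
  | @prec k f g ihf ihg =>
    intro q h
    cases q with
    | prec f' g' =>
      simp only [PR.code, Nat.pair_eq_pair, true_and] at h
      rw [ihf _ h.1, ihg _ h.2]
    | _ => simp_all [PR.code, Nat.pair_eq_pair]

theorem Term.code_injective {n : ℕ} : Function.Injective (Term.code (L := L) (n := n)) := by
  intro s
  induction s with
  | var i => intro t h; cases t <;> simp_all [Term.code, Nat.pair_eq_pair, Fin.ext_iff]
  | zero => intro t h; cases t <;> simp_all [Term.code, Nat.pair_eq_pair]
  | succ s ih =>
    intro t h
    cases t with
    | succ t =>
      simp only [Term.code, Nat.pair_eq_pair, true_and] at h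
      rw [ih h]
    | _ => simp_all [Term.code, Nat.pair_eq_pair]
  | add s s' ih ih' =>
    intro t h
    cases t with
    | add t t' =>
      simp only [Term.code, Nat.pair_eq_pair, true_and] at h
      rw [ih h.1, ih' h.2]
    | _ => simp_all [Term.code, Nat.pair_eq_pair]
  | mul s s' ih ih' =>
    intro t h
    cases t with
    | mul t t' =>
      simp only [Term.code, Nat.pair_eq_pair, true_and] at h
      rw [ih h.1, ih' h.2]
    | _ => simp_all [Term.code, Nat.pair_eq_pair]
  | @fn k f hf ts ih =>
    intro t h
    cases t with
    | @fn k' g hg us =>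
      simp only [Term.code, Nat.pair_eq_pair, true_and] at h
      obtain ⟨rfl, hfg, ht⟩ := h
      obtain rfl := PR.code_injective _ _ hfg
      rw [funext fun i => ih i (congrFun (tupleCode_injective ht) i)]
    | _ => simp_all [Term.code, Nat.pair_eq_pair]

theorem Fml.code_injective : ∀ {n : ℕ} (φ ψ : Fml L n), φ.code = ψ.code → φ = ψ := by
  intro n φ
  induction φ with
  | eq s t =>
    intro ψ h
    cases ψ with
    | eq s' t' =>
      simp only [Fml.code, eqCode, Nat.pair_eq_pair, true_and] at h
      rw [Term.code_injective h.1, Term.code_injective h.2]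
    | _ => simp_all [Fml.code, eqCode, trCode, negCode, orCode, andCode, allCode, exCode,
        Nat.pair_eq_pair]
  | tr t =>
    intro ψ h
    cases ψ with
    | tr t' =>
      simp only [Fml.code, trCode, Nat.pair_eq_pair, true_and] at h
      rw [Term.code_injective h]
    | _ => simp_all [Fml.code, eqCode, trCode, negCode, orCode, andCode, allCode, exCode,
        Nat.pair_eq_pair]
  | neg φ ih =>
    intro ψ h
    cases ψ with
    | neg φ' =>
      simp only [Fml.code, negCode, Nat.pair_eq_pair, true_and] at h
      rw [ih _ h]
    | _ => simp_all [Fml.code, eqCode, trCode, negCode, orCode, andCode, allCode, exCode,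
        Nat.pair_eq_pair]
  | or φ χ ih ih' =>
    intro ψ h
    cases ψ with
    | or φ' χ' =>
      simp only [Fml.code, orCode, Nat.pair_eq_pair, true_and] at h
      rw [ih _ h.1, ih' _ h.2]
    | _ => simp_all [Fml.code, eqCode, trCode, negCode, orCode, andCode, allCode, exCode,
        Nat.pair_eq_pair]
  | and φ χ ih ih' =>
    intro ψ h
    cases ψ with
    | and φ' χ' =>
      simp only [Fml.code, andCode, Nat.pair_eq_pair, true_and] at h
      rw [ih _ h.1, ih' _ h.2]
    | _ => simp_all [Fml.code, eqCode, trCode, negCode, orCode, andCode, allCode, exCode,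
        Nat.pair_eq_pair]
  | all φ ih =>
    intro ψ h
    cases ψ with
    | all φ' =>
      simp only [Fml.code, allCode, Nat.pair_eq_pair, true_and] at h
      rw [ih _ h]
    | _ => simp_all [Fml.code, eqCode, trCode, negCode, orCode, andCode, allCode, exCode,
        Nat.pair_eq_pair]
  | ex φ ih =>
    intro ψ h
    cases ψ with
    | ex φ' =>
      simp only [Fml.code, exCode, Nat.pair_eq_pair, true_and] at h
      rw [ih _ h]
    | _ => simp_all [Fml.code, eqCode, trCode, negCode, orCode, andCode, allCode, exCode,
        Nat.pair_eq_pair]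

theorem code_mem_Sent (φ : Sentence L) : φ.code ∈ Sent L := ⟨φ, rfl⟩

/-! ### Substitution -/

theorem Term.subst_subst {n m k : ℕ} (σ : Fin n → Term L m) (τ : Fin m → Term L k) (t : Term L n) :
    (t.subst σ).subst τ = t.subst fun i => (σ i).subst τ := by
  induction t <;> simp_all [Term.subst]

theorem liftSubst_subst {n m k : ℕ} (σ : Fin n → Term L m) (τ : Fin m → Term L k) :
    (fun i => (liftSubst σ i).subst (liftSubst τ)) = liftSubst fun i => (σ i).subst τ := by
  funext i
  refine Fin.cases ?_ (fun i => ?_) i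
  · rfl
  · simp only [liftSubst, Fin.cases_succ, Term.subst_subst]
    rfl

theorem Fml.subst_subst {n m k : ℕ} (σ : Fin n → Term L m) (τ : Fin m → Term L k) (φ : Fml L n) :
    (φ.subst σ).subst τ = φ.subst fun i => (σ i).subst τ := by
  induction φ generalizing m k with
  | all φ ih => simp only [Fml.subst, ih, liftSubst_subst]
  | ex φ ih => simp only [Fml.subst, ih, liftSubst_subst]
  | _ => simp_all [Fml.subst, Term.subst_subst]

theorem num_subst {n m : ℕ} (σ : Fin n → Term L m) (k : ℕ) : (num k).subst σ = num k := by
  induction k with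
  | zero => rfl
  | succ k ih => simp only [num, Term.subst, ih]

theorem num_code {n : ℕ} (k : ℕ) : (num k : Term L n).code = numCode k := by
  induction k with
  | zero => rfl
  | succ k ih => simp only [num, Term.code, ih]; rfl

theorem num_eval {n : ℕ} (e : Fin n → ℕ) (k : ℕ) : (num k : Term L n).eval e = k := by
  induction k with
  | zero => rfl
  | succ k ih => simp only [num, Term.eval, ih]

theorem num_val (k : ℕ) : (num k : CTerm L).val = k := num_eval _ k

theorem negTerm_val (t : CTerm L) : (negTerm t).val = negCode t.val := by
  rw [← L.negSym_eval]
  simp only [negTerm, Term.val, Term.eval]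
  congr 1
  funext i
  fin_cases i
  rfl

/-! ### Soundness of PAT in every expansion of the standard model -/

theorem Term.eval_subst {n m : ℕ} (σ : Fin n → Term L m) (e : Fin m → ℕ) (t : Term L n) :
    (t.subst σ).eval e = t.eval fun i => (σ i).eval e := by
  induction t <;> simp_all [Term.subst, Term.eval]

theorem eval_liftSubst {n m : ℕ} (σ : Fin n → Term L m) (e : Fin m → ℕ) (a : ℕ) :
    (fun i => (liftSubst σ i).eval (Fin.cases a e)) =
      (Fin.cases a fun i => (σ i).eval e : Fin (n + 1) → ℕ) := by
  funext i
  refine Fin.cases ?_ (fun i => ?_) i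
  · rfl
  · simp only [liftSubst, Fin.cases_succ, Term.eval_subst]
    rfl

theorem Fml.sat_subst (X : Set ℕ) {n m : ℕ} (σ : Fin n → Term L m) (e : Fin m → ℕ) (φ : Fml L n) :
    (φ.subst σ).Sat X e ↔ φ.Sat X fun i => (σ i).eval e := by
  induction φ generalizing m with
  | all φ ih => simp only [Fml.subst, Fml.Sat, ih, eval_liftSubst]
  | ex φ ih => simp only [Fml.subst, Fml.Sat, ih, eval_liftSubst]
  | _ => simp_all [Fml.subst, Fml.Sat, Term.eval_subst]

theorem Fml.sat_inst (X : Set ℕ) {n : ℕ} (e : Fin n → ℕ) (φ : Fml L (n + 1)) (t : Term L n) :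
    (φ.inst t).Sat X e ↔ φ.Sat X (Fin.cases (t.eval e) e) := by
  rw [Fml.inst, Fml.sat_subst]
  suffices h : (fun i => Term.eval e (Fin.cases t Term.var i : Term L n)) =
      (Fin.cases (t.eval e) e : Fin (n + 1) → ℕ) by rw [h]
  funext i
  exact Fin.cases rfl (fun _ => rfl) i

theorem Fml.sat_instSucc (X : Set ℕ) {n : ℕ} (e : Fin n → ℕ) (a : ℕ) (φ : Fml L (n + 1)) :
    φ.instSucc.Sat X (Fin.cases a e) ↔ φ.Sat X (Fin.cases (a + 1) e) := by
  rw [Fml.instSucc, Fml.sat_subst]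
  suffices h : (fun i => Term.eval (Fin.cases a e)
      (Fin.cases (.succ (.var 0)) (fun i => .var i.succ) i : Term L (n + 1))) =
      (Fin.cases (a + 1) e : Fin (n + 1) → ℕ) by rw [h]
  funext i
  exact Fin.cases rfl (fun _ => rfl) i

theorem Fml.sat_shift (X : Set ℕ) {n : ℕ} (e : Fin n → ℕ) (a : ℕ) (φ : Fml L n) :
    φ.shift.Sat X (Fin.cases a e) ↔ φ.Sat X e := by
  rw [Fml.shift, Fml.sat_subst]
  rfl

theorem Fml.sat_imp (X : Set ℕ) {n : ℕ} (e : Fin n → ℕ) (φ ψ : Fml L n) :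
    (φ.imp ψ).Sat X e ↔ (φ.Sat X e → ψ.Sat X e) := by
  simp only [Fml.imp, Fml.Sat, imp_iff_not_or]

theorem Fml.sat_iff (X : Set ℕ) {n : ℕ} (e : Fin n → ℕ) (φ ψ : Fml L n) :
    (φ.iff ψ).Sat X e ↔ (φ.Sat X e ↔ ψ.Sat X e) := by
  simp only [Fml.iff, Fml.Sat, Fml.sat_imp, iff_def]

theorem eval_finCons {n k : ℕ} (e : Fin n → ℕ) (t : Term L n) (ts : Fin k → Term L n) :
    (fun i => Term.eval e ((Fin.cons t ts : Fin (k + 1) → Term L n) i)) =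
      (Fin.cons (t.eval e) (fun i => (ts i).eval e) : Fin (k + 1) → ℕ) := by
  funext i
  exact Fin.cases rfl (fun _ => rfl) i

theorem PATAxiom.sat (X : Set ℕ) {n : ℕ} {φ : Fml L n} (h : PATAxiom φ) (e : Fin n → ℕ) :
    φ.Sat X e := by
  induction h with
  | induction φ =>
    rw [Fml.sat_imp]
    rintro ⟨h0, hs⟩ a
    induction a with
    | zero => exact (Fml.sat_inst X e φ .zero).1 h0
    | succ a ih =>
      exact (Fml.sat_instSucc X e a φ).1 ((Fml.sat_imp X _ _ _).1 (hs a) ih)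
  | succ_inj s t =>
    rw [Fml.sat_imp]
    simp [Fml.Sat, Term.eval]
  | mul_succ s t => simp [Fml.Sat, Term.eval, Nat.mul_succ]
  | add_succ s t => simp [Fml.Sat, Term.eval, Nat.add_assoc]
  | fn_prec_zero f g h ts =>
    simp only [Fml.Sat, Term.eval, eval_finCons, PR.eval, Fin.cons_zero, Fin.tail_cons]
    rfl
  | fn_prec_succ f g h t ts =>
    simp only [Fml.Sat, Term.eval, eval_finCons, PR.eval, Fin.cons_zero, Fin.tail_cons]
  | _ => simp [Fml.Sat, Term.eval, PR.eval]

theorem Derives.sat (X : Set ℕ) {n : ℕ} {Γ : List (Fml L n)} {φ : Fml L n} (h : Derives Γ φ) :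
    ∀ e : Fin n → ℕ, (∀ ψ ∈ Γ, ψ.Sat X e) → φ.Sat X e := by
  have cons : ∀ {n : ℕ} {e : Fin n → ℕ} {Γ : List (Fml L n)} {φ : Fml L n}, φ.Sat X e →
      (∀ ψ ∈ Γ, ψ.Sat X e) → ∀ ψ ∈ φ :: Γ, ψ.Sat X e := by
    intro n e Γ φ hφ hΓ ψ hψ
    rcases List.mem_cons.1 hψ with rfl | hψ
    exacts [hφ, hΓ ψ hψ]
  have shift : ∀ {n : ℕ} {e : Fin n → ℕ} {Γ : List (Fml L n)} (a : ℕ),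
      (∀ ψ ∈ Γ, ψ.Sat X e) → ∀ ψ ∈ Γ.map Fml.shift, ψ.Sat X (Fin.cases a e) := by
    intro n e Γ a hΓ ψ hψ
    obtain ⟨χ, hχ, rfl⟩ := List.mem_map.1 hψ
    exact (Fml.sat_shift X e a χ).2 (hΓ χ hχ)
  induction h with
  | ax h => intro e _; exact h.sat X e
  | hyp h => intro e hΓ; exact hΓ _ h
  | negI _ _ ih₁ ih₂ =>
    intro e hΓ hφ
    exact ih₂ e (cons hφ hΓ) (ih₁ e (cons hφ hΓ))
  | raa _ _ ih₁ ih₂ =>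
    intro e hΓ
    by_contra hφ
    exact ih₂ e (cons hφ hΓ) (ih₁ e (cons hφ hΓ))
  | andI _ _ ih₁ ih₂ => intro e hΓ; exact ⟨ih₁ e hΓ, ih₂ e hΓ⟩
  | andE₁ _ ih => intro e hΓ; exact (ih e hΓ).1
  | andE₂ _ ih => intro e hΓ; exact (ih e hΓ).2
  | orI₁ _ ih => intro e hΓ; exact Or.inl (ih e hΓ)
  | orI₂ _ ih => intro e hΓ; exact Or.inr (ih e hΓ)
  | orE _ _ _ ih ih₁ ih₂ =>
    intro e hΓ
    rcases ih e hΓ with h | h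
    exacts [ih₁ e (cons h hΓ), ih₂ e (cons h hΓ)]
  | allI _ ih => intro e hΓ a; exact ih _ (shift a hΓ)
  | allE t _ ih => intro e hΓ; exact (Fml.sat_inst X e _ t).2 (ih e hΓ _)
  | exI t _ ih => intro e hΓ; exact ⟨_, (Fml.sat_inst X e _ t).1 (ih e hΓ)⟩
  | exE _ _ ih₁ ih₂ =>
    intro e hΓ
    obtain ⟨a, ha⟩ := ih₁ e hΓ
    exact (Fml.sat_shift X e a _).1 (ih₂ _ (cons ha (shift a hΓ)))
  | eqI t => intro e _; rfl
  | eqE φ _ _ ih₁ ih₂ =>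
    intro e hΓ
    have h₁ := ih₁ e hΓ
    have h₂ := (Fml.sat_inst X e _ _).1 (ih₂ e hΓ)
    rw [Fml.Sat] at h₁
    rw [h₁] at h₂
    exact (Fml.sat_inst X e _ _).2 h₂

theorem models_imp {X : Set ℕ} {φ ψ : Sentence L} :
    Models X (φ.imp ψ) ↔ (Models X φ → Models X ψ) := Fml.sat_imp X _ φ ψ

theorem models_iff {X : Set ℕ} {φ ψ : Sentence L} :
    Models X (φ.iff ψ) ↔ (Models X φ ↔ Models X ψ) := Fml.sat_iff X _ φ ψ

theorem Provable.models {φ : Sentence L} (h : Provable φ) (X : Set ℕ) : Models X φ :=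
  Derives.sat X h _ (by simp)

theorem IsTruthTeller.models_iff {τ : Sentence L} (h : IsTruthTeller τ) (X : Set ℕ) :
    Models X τ ↔ τ.code ∈ X := by
  have := SupTruth.models_iff.1 (h.models X)
  rwa [Models, Models, Fml.Sat, Fml.quote, num_eval] at this

theorem IsLiar.models_iff {l : Sentence L} (h : IsLiar l) (X : Set ℕ) :
    Models X l ↔ l.code ∉ X := by
  have := SupTruth.models_iff.1 (h.models X)
  rwa [Models, Models, Fml.Sat, Fml.Sat, Fml.quote, num_eval] at this

/-! ### Equational reasoning in PAT -/

theorem Derives.imp_intro {n : ℕ} {Γ : List (Fml L n)} {φ ψ : Fml L n}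
    (h : Derives (φ :: Γ) ψ) : Derives Γ (φ.imp ψ) := by
  have em : Derives Γ (.or (.neg φ) φ) := by
    refine .raa (ψ := .or (.neg φ) φ) (.orI₁ (.negI (ψ := .or (.neg φ) φ) ?_ ?_)) (.hyp (by simp))
    · exact .orI₂ (.hyp (by simp))
    · exact .hyp (by simp)
  exact .orE em (.orI₁ (.hyp (by simp))) (.orI₂ h)

theorem Derives.iff_intro {n : ℕ} {Γ : List (Fml L n)} {φ ψ : Fml L n}
    (h₁ : Derives (φ :: Γ) ψ) (h₂ : Derives (ψ :: Γ) φ) : Derives Γ (φ.iff ψ) :=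
  .andI h₁.imp_intro h₂.imp_intro

theorem Term.subst_var {n : ℕ} (t : Term L n) : t.subst .var = t := by
  induction t <;> simp_all [Term.subst]

theorem Derives.subst_update {n k : ℕ} {Γ : List (Fml L n)} (φ : Fml L k) (σ : Fin k → Term L n)
    (j : Fin k) {s t : Term L n} (h : Derives Γ (.eq s t))
    (hφ : Derives Γ (φ.subst (Function.update σ j s))) :
    Derives Γ (φ.subst (Function.update σ j t)) := by
  have key : ∀ u : Term L n, (φ.subst fun i => if i = j then .var 0 else
      (σ i).subst fun i => .var i.succ).inst u = φ.subst (Function.update σ j u) := by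
    intro u
    rw [Fml.inst, Fml.subst_subst]
    congr 1
    funext i
    by_cases hi : i = j
    · subst hi
      simp [Term.subst]
    · simp only [hi, if_false, Term.subst_subst, Function.update_of_ne hi]
      exact Term.subst_var _
  rw [← key] at hφ ⊢
  exact .eqE _ h hφ

theorem Derives.subst_congr {n k : ℕ} {Γ : List (Fml L n)} (φ : Fml L k) {σ τ : Fin k → Term L n}
    (h : ∀ i, Derives Γ (.eq (σ i) (τ i))) (hφ : Derives Γ (φ.subst σ)) :
    Derives Γ (φ.subst τ) := by
  -- The arguments are replaced one at a time.
  have key : ∀ s : Finset (Fin k), Derives Γ (φ.subst fun i => if i ∈ s then τ i else σ i) := by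
    intro s
    induction s using Finset.induction_on with
    | empty => simpa using hφ
    | insert j s hj ih =>
      have h₁ : (fun i => if i ∈ s then τ i else σ i) =
          Function.update (fun i => if i ∈ s then τ i else σ i) j (σ j) := by
        rw [eq_comm, Function.update_eq_self_iff]
        simp [hj]
      have h₂ : (fun i => if i ∈ insert j s then τ i else σ i) =
          Function.update (fun i => if i ∈ s then τ i else σ i) j (τ j) := by
        funext i
        by_cases hi : i = j
        · subst hi; simp
        · simp [hi]
      rw [h₁] at ih
      rw [h₂]
      exact Derives.subst_update φ _ j (h j) ih
  simpa using key Finset.univ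

theorem Derives.eq_trans {n : ℕ} {Γ : List (Fml L n)} {s t u : Term L n}
    (h₁ : Derives Γ (.eq s t)) (h₂ : Derives Γ (.eq t u)) : Derives Γ (.eq s u) := by
  have key := Derives.subst_congr (Γ := Γ) (.eq (.var 0) (.var 1)) (σ := ![s, t]) (τ := ![s, u])
    (Fin.forall_fin_two.2 ⟨.eqI s, h₂⟩)
  simp only [Fml.subst, Term.subst] at key
  exact key h₁

theorem Derives.eq_symm {n : ℕ} {Γ : List (Fml L n)} {s t : Term L n}
    (h : Derives Γ (.eq s t)) : Derives Γ (.eq t s) := by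
  have key := Derives.subst_congr (Γ := Γ) (.eq (.var 0) (.var 1)) (σ := ![s, s]) (τ := ![t, s])
    (Fin.forall_fin_two.2 ⟨h, .eqI s⟩)
  simp only [Fml.subst, Term.subst] at key
  exact key (.eqI s)

theorem Derives.fn_congr {n k : ℕ} {Γ : List (Fml L n)} (f : PR k) (hf : L.sym f)
    {ts us : Fin k → Term L n} (h : ∀ i, Derives Γ (.eq (ts i) (us i))) :
    Derives Γ (.eq (.fn f hf ts) (.fn f hf us)) := by
  have key := Derives.subst_congr (Γ := Γ)
    (.eq (.fn f hf fun i => .var (Fin.castAdd k i)) (.fn f hf fun i => .var (Fin.natAdd k i)))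
    (σ := Fin.append ts ts) (τ := Fin.append ts us)
    (by
      intro i
      refine Fin.addCases (fun i => ?_) (fun i => ?_) i
      · simpa only [Fin.append_left] using .eqI _
      · simpa only [Fin.append_right] using h i)
  simp only [Fml.subst, Term.subst, Fin.append_left, Fin.append_right] at key
  exact key (.eqI _)

/-- The recursion equations suffice to compute the values of a function symbol at numerals. -/
theorem Derives.fn_num {n : ℕ} {Γ : List (Fml L n)} {k : ℕ} (f : PR k) (hf : L.sym f)
    (v : Fin k → ℕ) : Derives Γ (.eq (.fn f hf fun i => num (v i)) (num (f.eval v))) := by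
  induction f with
  | zero => exact .ax (.fn_zero hf _)
  | succ => exact .ax (.fn_succ hf _)
  | proj i => exact .ax (.fn_proj i hf _)
  | comp f g ihf ihg =>
    exact (Derives.ax (.fn_comp f g hf _)).eq_trans
      ((Derives.fn_congr f _ fun i => ihg i _ v).eq_trans (ihf _ _))
  | @prec k f g ihf ihg =>
    have cons : ∀ {m : ℕ} (y : ℕ) (w : Fin m → ℕ),
        (fun i => num ((Fin.cons y w : Fin (m + 1) → ℕ) i) : Fin (m + 1) → Term L n) =
          Fin.cons (num y) fun i => num (w i) := by
      intro m y w
      funext i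
      exact Fin.cases rfl (fun _ => rfl) i
    obtain ⟨y, w, rfl⟩ : ∃ (y : ℕ) (w : Fin k → ℕ), v = Fin.cons y w :=
      ⟨v 0, Fin.tail v, (Fin.cons_self_tail v).symm⟩
    induction y with
    | zero =>
      rw [cons]
      exact (Derives.ax (.fn_prec_zero f g hf _)).eq_trans (ihf _ w)
    | succ y ih =>
      rw [cons] at ih ⊢
      refine (Derives.ax (.fn_prec_succ f g hf (num y) _)).eq_trans
        (Derives.eq_trans ?_ (ihg (L.sym_prec f g hf).2
          (Fin.cons y (Fin.cons ((PR.prec f g).eval (Fin.cons y w)) w))))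
      refine Derives.fn_congr g _ fun i => ?_
      refine Fin.cases (.eqI _) (fun i => ?_) i
      exact Fin.cases ih (fun i => .eqI _) i

theorem Derives.fn_eq_num {n : ℕ} {Γ : List (Fml L n)} {k : ℕ} (f : PR k) (hf : L.sym f)
    {ts : Fin k → Term L n} {v : Fin k → ℕ} (h : ∀ i, Derives Γ (.eq (ts i) (num (v i)))) :
    Derives Γ (.eq (.fn f hf ts) (num (f.eval v))) :=
  (Derives.fn_congr f hf h).eq_trans (.fn_num f hf v)

/-! ### Diagonalization -/

variable (L) in
/-- A term for the operation that sends the code of `φ(x)` to the code of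
`∃ x (x = e ∧ φ(x))`, where `e` is the numeral of the code of `φ(x)`. It is composed of the
available symbols for operations on codes; no symbol for substitution is needed. -/
def diagTerm {n : ℕ} (t : Term L n) : Term L n :=
  .fn L.exSym L.exSym_mem ![.fn L.andSym L.andSym_mem
    ![.fn L.eqSym L.eqSym_mem ![num (Nat.pair 0 0), .fn L.numSym L.numSym_mem ![t]], t]]

theorem diagTerm_subst {n m : ℕ} (σ : Fin n → Term L m) (t : Term L n) :
    (diagTerm L t).subst σ = diagTerm L (t.subst σ) := by
  have h1 : ∀ s : Term L n, (fun i => (![s] i).subst σ) = ![s.subst σ] := fun s => by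
    funext i; fin_cases i; rfl
  have h2 : ∀ s u : Term L n, (fun i => (![s, u] i).subst σ) = ![s.subst σ, u.subst σ] :=
    fun s u => by funext i; fin_cases i <;> rfl
  simp only [diagTerm, Term.subst, h1, h2, num_subst]

theorem Derives.diagTerm_eq {n : ℕ} {Γ : List (Fml L n)} {t : Term L n} {e : ℕ}
    (h : Derives Γ (.eq t (num e))) : Derives Γ (.eq (diagTerm L t)
      (num (exCode (andCode (eqCode (Nat.pair 0 0) (numCode e)) e)))) := by
  rw [← L.exSym_eval, ← L.andSym_eval, ← L.eqSym_eval, ← L.numSym_eval]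
  refine .fn_eq_num _ _ fun i => ?_
  fin_cases i
  refine .fn_eq_num _ _ (Fin.forall_fin_two.2 ⟨.fn_eq_num _ _ (Fin.forall_fin_two.2
    ⟨.eqI _, .fn_eq_num _ _ fun i => ?_⟩), h⟩)
  fin_cases i
  exact h

/-- `φ(d(x))`, where `d` is the diagonal operation. -/
def diagBody (φ : Fml L 1) : Fml L 1 := φ.subst fun _ => diagTerm L (.var 0)

/-- The diagonal sentence of `φ(x)`, which says `φ` of its own code. -/
def diagSentence (φ : Fml L 1) : Sentence L :=
  .ex (.and (.eq (.var 0) (num (diagBody φ).code)) (diagBody φ))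

theorem diagSentence_code (φ : Fml L 1) : (diagSentence φ).code =
    exCode (andCode (eqCode (Nat.pair 0 0) (numCode (diagBody φ).code)) (diagBody φ).code) := by
  simp only [diagSentence, Fml.code, num_code, Term.code]
  rfl

theorem Derives.of_diagSentence {Γ : List (Sentence L)} (φ : Fml L 1)
    (h : Derives Γ (diagSentence φ)) :
    Derives Γ (φ.subst fun _ => (diagSentence φ).quote) := by
  refine .exE h ?_
  rw [Fml.shift, Fml.subst_subst]
  simp only [Fml.quote, num_subst]
  rw [diagSentence_code]
  refine Derives.subst_congr φ (σ := fun _ => diagTerm L (.var 0)) (fun _ => ?_)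
    (.andE₂ (.hyp (List.mem_cons_self ..)))
  exact .diagTerm_eq (.andE₁ (.hyp (List.mem_cons_self ..)))

theorem Derives.diagSentence {Γ : List (Sentence L)} (φ : Fml L 1)
    (h : Derives Γ (φ.subst fun _ => (diagSentence φ).quote)) :
    Derives Γ (diagSentence φ) := by
  refine .exI (num (diagBody φ).code) ?_
  rw [Fml.inst, Fml.subst, Fml.subst, Term.subst, num_subst]
  refine .andI (.eqI _) ?_
  rw [diagBody, Fml.subst_subst]
  simp only [diagTerm_subst, Term.subst]
  refine Derives.subst_congr φ (fun _ => ?_) h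
  rw [Fml.quote, diagSentence_code]
  exact (Derives.diagTerm_eq (.eqI _)).eq_symm

theorem isTruthTeller_diagSentence : IsTruthTeller (diagSentence (L := L) (.tr (.var 0))) := by
  have h₁ := fun Γ => Derives.of_diagSentence (L := L) (Γ := Γ) (.tr (.var 0))
  have h₂ := fun Γ => Derives.diagSentence (L := L) (Γ := Γ) (.tr (.var 0))
  simp only [Fml.subst, Term.subst] at h₁ h₂
  exact .iff_intro (h₁ _ (.hyp (List.mem_cons_self ..))) (h₂ _ (.hyp (List.mem_cons_self ..)))

theorem isTruthTeller_diagSentence_and :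
    IsTruthTeller (diagSentence (L := L) (.and (.tr (.var 0)) (.tr (.var 0)))) := by
  have h₁ := fun Γ => Derives.of_diagSentence (L := L) (Γ := Γ) (.and (.tr (.var 0)) (.tr (.var 0)))
  have h₂ := fun Γ => Derives.diagSentence (L := L) (Γ := Γ) (.and (.tr (.var 0)) (.tr (.var 0)))
  simp only [Fml.subst, Term.subst] at h₁ h₂
  exact .iff_intro (.andE₁ (h₁ _ (.hyp (List.mem_cons_self ..))))
    (h₂ _ (.andI (.hyp (List.mem_cons_self ..)) (.hyp (List.mem_cons_self ..))))

theorem isLiar_diagSentence : IsLiar (diagSentence (L := L) (.neg (.tr (.var 0)))) := by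
  have h₁ := fun Γ => Derives.of_diagSentence (L := L) (Γ := Γ) (.neg (.tr (.var 0)))
  have h₂ := fun Γ => Derives.diagSentence (L := L) (Γ := Γ) (.neg (.tr (.var 0)))
  simp only [Fml.subst, Term.subst] at h₁ h₂
  exact .iff_intro (h₁ _ (.hyp (List.mem_cons_self ..))) (h₂ _ (.hyp (List.mem_cons_self ..)))

theorem isLiar_diagSentence_and :
    IsLiar (diagSentence (L := L) (.and (.neg (.tr (.var 0))) (.neg (.tr (.var 0))))) := by
  have h₁ := fun Γ => Derives.of_diagSentence (L := L) (Γ := Γ)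
    (.and (.neg (.tr (.var 0))) (.neg (.tr (.var 0))))
  have h₂ := fun Γ => Derives.diagSentence (L := L) (Γ := Γ)
    (.and (.neg (.tr (.var 0))) (.neg (.tr (.var 0))))
  simp only [Fml.subst, Term.subst] at h₁ h₂
  exact .iff_intro (.andE₁ (h₁ _ (.hyp (List.mem_cons_self ..))))
    (h₂ _ (.andI (.hyp (List.mem_cons_self ..)) (.hyp (List.mem_cons_self ..))))

theorem exists_isTruthTeller_ne :
    ∃ τ₁ τ₂ : Sentence L, IsTruthTeller τ₁ ∧ IsTruthTeller τ₂ ∧ τ₁ ≠ τ₂ :=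
  ⟨_, _, isTruthTeller_diagSentence, isTruthTeller_diagSentence_and,
    by simp [diagSentence, diagBody, Fml.subst]⟩

theorem exists_isLiar_ne : ∃ l₁ l₂ : Sentence L, IsLiar l₁ ∧ IsLiar l₂ ∧ l₁ ≠ l₂ :=
  ⟨_, _, isLiar_diagSentence, isLiar_diagSentence_and,
    by simp [diagSentence, diagBody, Fml.subst]⟩

/-! ### Supervaluation over a family of interpretations -/

variable (L) in
/-- The set of codes of the sentences true in `(ℕ, X)`. -/
def theory (X : Set ℕ) : Set ℕ := {n | ∃ φ : Sentence L, φ.code = n ∧ Models X φ}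

variable (L) in
/-- The set of codes of the sentences true in `(ℕ, X)` for every member `X` of the family `F`. -/
def supTruths (F : Set (Set ℕ)) : Set ℕ :=
  {n | ∃ φ : Sentence L, φ.code = n ∧ ∀ X ∈ F, Models X φ}

theorem code_mem_theory {X : Set ℕ} {φ : Sentence L} : φ.code ∈ theory L X ↔ Models X φ := by
  constructor
  · rintro ⟨ψ, h, hψ⟩
    rwa [← Fml.code_injective _ _ h]
  · exact fun h => ⟨φ, rfl, h⟩

theorem code_mem_supTruths {F : Set (Set ℕ)} {φ : Sentence L} :
    φ.code ∈ supTruths L F ↔ ∀ X ∈ F, Models X φ := by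
  constructor
  · rintro ⟨ψ, h, hψ⟩
    rwa [← Fml.code_injective _ _ h]
  · exact fun h => ⟨φ, rfl, h⟩

theorem theory_subset_Sent (X : Set ℕ) : theory L X ⊆ Sent L := fun _ ⟨φ, h, _⟩ => ⟨φ, h⟩

theorem supTruths_subset_Sent (F : Set (Set ℕ)) : supTruths L F ⊆ Sent L :=
  fun _ ⟨φ, h, _⟩ => ⟨φ, h⟩

theorem supTruths_subset_theory {F : Set (Set ℕ)} {X : Set ℕ} (hX : X ∈ F) :
    supTruths L F ⊆ theory L X := fun _ ⟨φ, h, hφ⟩ => ⟨φ, h, hφ X hX⟩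

theorem supTruths_anti {F G : Set (Set ℕ)} (h : F ⊆ G) : supTruths L G ⊆ supTruths L F :=
  fun _ ⟨φ, hn, hφ⟩ => ⟨φ, hn, fun X hX => hφ X (h hX)⟩

theorem CON_theory (X : Set ℕ) : CON L (theory L X) := by
  rintro ⟨φ, h, h'⟩
  exact code_mem_theory.1 h' (code_mem_theory.1 h)

theorem MXC_theory (X : Set ℕ) : MXC L (theory L X) :=
  ⟨CON_theory X, fun _ h => code_mem_theory.2 fun h' => h (code_mem_theory.2 h')⟩

theorem CON.mono {X Y : Set ℕ} (h : X ⊆ Y) (hY : CON L Y) : CON L X :=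
  fun ⟨φ, h₁, h₂⟩ => hY ⟨φ, h h₁, h h₂⟩

/-- The properties that make the family `F S` of candidate interpretations of the truth predicate,
given the set `S` of sentences already accepted, suitable for interpreting the clauses of `ξ*`.
The last one, closure under passing from `X` to the theory of `(ℕ, X)`, accounts for the clauses
that eliminate the truth predicate. -/
structure IsScheme (L : ArithLang) (F : Set ℕ → Set (Set ℕ)) : Prop where
  anti : Antitone F
  subset_Sent : ∀ {S X}, X ∈ F S → X ⊆ Sent L
  subset : ∀ {S X}, X ∈ F S → S ⊆ X
  notMem : ∀ {S X}, X ∈ F S → ∀ φ : Sentence L, φ.neg.code ∈ S → φ.code ∉ X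
  theory_mem : ∀ {S X}, S ⊆ supTruths L (F S) → X ∈ F S → theory L X ∈ F S

/-- If the members of `S` hold throughout `F S`, then so do the sentences with `ξ*(·, S)`. For the
elimination clauses: if `Tr t ∈ S` and `φ` has code `t°`, then for `X` in the family the theory of
`(ℕ, X)` is also in the family and makes `Tr t` true, which means that `(ℕ, X) ⊨ φ`. -/
theorem XiStar.models {F : Set ℕ → Set (Set ℕ)} (hF : IsScheme L F) {S : Set ℕ}
    (hS : S ⊆ supTruths L (F S)) {ψ : Sentence L} (h : XiStar S ψ) {X : Set ℕ} (hX : X ∈ F S) :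
    Models X ψ := by
  have hSX : ∀ {φ : Sentence L}, φ.code ∈ S → ∀ {X : Set ℕ}, X ∈ F S → Models X φ :=
    fun h _ hX => code_mem_supTruths.1 (hS h) _ hX
  have inst : ∀ (φ : Fml L 1) (t : CTerm L), Models X (φ.inst t) ↔
      φ.Sat X (Fin.cases t.val Fin.elim0) := fun φ t => Fml.sat_inst X _ φ t
  cases h with
  | eq s t h => exact h
  | ne s t h => exact h
  | or φ ψ h => exact h.imp (hSX · hX) (hSX · hX)
  | and φ ψ h => exact ⟨hSX h.1 hX, hSX h.2 hX⟩
  | all φ h =>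
    intro a
    have := (inst φ (num a)).1 (hSX (h (num a)) hX)
    rwa [num_val] at this
  | ex φ h =>
    obtain ⟨t, ht⟩ := h
    exact ⟨t.val, (inst φ t).1 (hSX ht hX)⟩
  | tr t h => exact hF.subset hX h
  | negTr t h =>
    intro ht
    rcases h with h | h
    · obtain ⟨φ, hφ⟩ := hF.subset_Sent hX ht
      refine hF.notMem hX φ ?_ (hφ ▸ ht)
      change negCode φ.code ∈ S
      rwa [hφ]
    · exact h (hF.subset_Sent hX ht)
  | trElim _ t h h' =>
    have := hSX h' (hF.theory_mem hS hX)
    rw [Models, Fml.Sat] at this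
    change t.val ∈ _ at this
    rw [← h] at this
    exact code_mem_theory.1 this
  | negTrElim φ t h h' =>
    intro hφ
    refine hSX h' (hF.theory_mem hS hX) ?_
    change t.val ∈ _
    rw [← h]
    exact code_mem_theory.2 hφ

/-! ### The operators `Θ*` -/

variable (L) in
/-- The operator `Θ*` with additional initial sentences `A`: this is `Θ*`, `Θ*_c` and `Θ*_mc` for
`A` respectively empty, `IsCon` and `IsCom`. -/
def thetaWith (A : Sentence L → Prop) (S : Set ℕ) : Set ℕ :=
  {n | ∃ φ : Sentence L, φ.code = n ∧
    ∃ ψ : Sentence L, (XiStar S ψ ∨ A ψ) ∧ Provable (ψ.imp φ)}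

theorem ThetaStar_eq : ThetaStar L = thetaWith L fun _ => False := by
  funext S
  simp only [ThetaStar, thetaWith, or_false]

theorem thetaWith_subset_Sent (A : Sentence L → Prop) (S : Set ℕ) : thetaWith L A S ⊆ Sent L :=
  fun _ ⟨φ, h, _⟩ => ⟨φ, h⟩

/-- Every sentence `φ` in `S` is obtained from the disjunction `φ ∨ φ`. -/
theorem subset_thetaWith (A : Sentence L → Prop) {S : Set ℕ} (hS : S ⊆ Sent L) :
    S ⊆ thetaWith L A S := by
  intro n hn
  obtain ⟨φ, rfl⟩ := hS hn
  refine ⟨φ, rfl, .or φ φ, Or.inl (.or φ φ (Or.inl hn)), Derives.imp_intro ?_⟩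
  exact .orE (.hyp (List.mem_cons_self ..)) (.hyp (List.mem_cons_self ..))
    (.hyp (List.mem_cons_self ..))

theorem thetaWith_subset_supTruths {F : Set ℕ → Set (Set ℕ)} (hF : IsScheme L F)
    {A : Sentence L → Prop} {S : Set ℕ} (hA : ∀ ψ, A ψ → ∀ X ∈ F S, Models X ψ)
    (hS : S ⊆ supTruths L (F S)) : thetaWith L A S ⊆ supTruths L (F S) := by
  rintro _ ⟨φ, rfl, ψ, hψ, hp⟩
  refine ⟨φ, rfl, fun X hX => models_imp.1 (hp.models X) ?_⟩
  exact hψ.elim (fun h => h.models hF hS hX) fun h => hA ψ h X hX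

theorem eq_thetaWith_of_eq_supTruths {F : Set ℕ → Set (Set ℕ)} (hF : IsScheme L F)
    {A : Sentence L → Prop} {S : Set ℕ} (hA : ∀ ψ, A ψ → ∀ X ∈ F S, Models X ψ)
    (hS : S = supTruths L (F S)) : S = thetaWith L A S := by
  refine subset_antisymm (subset_thetaWith A ?_) ?_
  · rw [hS]
    exact supTruths_subset_Sent _
  · exact (thetaWith_subset_supTruths hF hA hS.subset).trans hS.symm.subset

theorem classicallySound_of_subset_supTruths {F : Set (Set ℕ)} {S : Set ℕ}
    (hS : S ⊆ supTruths L F) (h : S ∈ F) : ClassicallySound L S :=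
  fun _ hφ => code_mem_supTruths.1 (hS hφ) S h

theorem IsCon.models {X : Set ℕ} (hX : X ⊆ Sent L) (hC : CON L X) {ψ : Sentence L} (h : IsCon ψ) :
    Models X ψ := by
  obtain ⟨s, t, hst, rfl⟩ := h
  rintro ⟨hs, ht⟩
  change s.val ∈ X at hs
  change (negTerm t).val ∈ X at ht
  rw [negTerm_val, ← hst] at ht
  obtain ⟨φ, hφ⟩ := hX hs
  rw [← hφ] at hs ht
  exact hC ⟨φ, hs, ht⟩

theorem IsCom.models {X : Set ℕ} (hC : MXC L X) {ψ : Sentence L} (h : IsCom ψ) : Models X ψ := by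
  obtain ⟨s, t, hst, ⟨φ, hφ⟩, rfl⟩ := h
  rw [models_iff]
  change s.val ∉ X ↔ (negTerm t).val ∈ X
  rw [negTerm_val, ← hst, ← hφ]
  exact ⟨hC.2 φ, fun h h' => hC.1 ⟨φ, h', h⟩⟩

/-! ### Transfinite iteration -/

section Iteration

variable {Φ : Set ℕ → Set ℕ} {X₀ : Set ℕ}

theorem stage_zero : stage Φ X₀ 0 = X₀ := Ordinal.limitRecOn_zero ..

theorem stage_succ (α : Ordinal.{0}) : stage Φ X₀ (α + 1) = Φ (stage Φ X₀ α) :=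
  Ordinal.limitRecOn_add_one ..

theorem stage_limit {α : Ordinal.{0}} (h : Order.IsSuccLimit α) :
    stage Φ X₀ α = ⋃ β : Set.Iio α, stage Φ X₀ β := Ordinal.limitRecOn_limit _ _ _ _ h

theorem subset_closureUnder : X₀ ⊆ closureUnder Φ X₀ :=
  (stage_zero (Φ := Φ)).symm.subset.trans (Set.subset_iUnion (stage Φ X₀) 0)

theorem stage_subset {T : Set ℕ} (h₀ : X₀ ⊆ T) (h : ∀ S ⊆ T, Φ S ⊆ T) (α : Ordinal.{0}) :
    stage Φ X₀ α ⊆ T := by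
  induction α using Ordinal.limitRecOn with
  | zero => rwa [stage_zero]
  | add_one α ih => rw [stage_succ]; exact h _ ih
  | limit α hα ih =>
    rw [stage_limit hα]
    exact Set.iUnion_subset fun β => ih β.1 β.2

theorem stage_monotone (h : ∀ α, stage Φ X₀ α ⊆ Φ (stage Φ X₀ α)) : Monotone (stage Φ X₀) := by
  intro α β
  induction β using Ordinal.limitRecOn with
  | zero => intro hα; rw [nonpos_iff_eq_zero.1 hα]
  | add_one β ih =>
    intro hα
    rcases hα.eq_or_lt with rfl | hα
    · exact le_rfl
    · rw [stage_succ]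
      exact (ih (Order.lt_add_one_iff.1 hα)).trans (h β)
  | limit β hβ ih =>
    intro hα
    rcases hα.eq_or_lt with rfl | hα
    · exact le_rfl
    · rw [stage_limit hβ]
      exact Set.subset_iUnion (fun γ : Set.Iio β => stage Φ X₀ γ) ⟨α, hα⟩

/-- An increasing iteration stabilizes, since there are only countably many natural numbers to be
added. -/
theorem closureUnder_eq_apply (h : ∀ α, stage Φ X₀ α ⊆ Φ (stage Φ X₀ α)) :
    closureUnder Φ X₀ = Φ (closureUnder Φ X₀) := by
  obtain ⟨α, hα⟩ : ∃ α, closureUnder Φ X₀ = stage Φ X₀ α := by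
    have : ∀ n, ∃ α : Ordinal.{0}, n ∈ closureUnder Φ X₀ → n ∈ stage Φ X₀ α := by
      intro n
      by_cases hn : n ∈ closureUnder Φ X₀
      · obtain ⟨α, hα⟩ := Set.mem_iUnion.1 hn
        exact ⟨α, fun _ => hα⟩
      · exact ⟨0, fun h => absurd h hn⟩
    choose f hf using this
    exact ⟨⨆ n, f n, subset_antisymm
      (fun n hn => stage_monotone h (Ordinal.le_iSup f n) (hf n hn)) (Set.subset_iUnion _ _)⟩
  rw [hα]
  refine subset_antisymm (h α) ?_
  rw [← stage_succ (Φ := Φ), ← hα]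
  exact Set.subset_iUnion _ _

/-- Induction along an increasing iteration, for properties preserved by unions of chains. -/
theorem closureUnder_induction {P : Set ℕ → Prop} (h : ∀ α, stage Φ X₀ α ⊆ Φ (stage Φ X₀ α))
    (h₀ : P X₀) (hΦ : ∀ S, P S → P (Φ S))
    (hU : ∀ (ι : Type 1) [LinearOrder ι] [Nonempty ι] (f : ι → Set ℕ), Monotone f →
      (∀ i, P (f i)) → P (⋃ i, f i)) : P (closureUnder Φ X₀) := by
  refine hU _ _ (stage_monotone h) fun α => ?_
  induction α using Ordinal.limitRecOn with
  | zero => rwa [stage_zero]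
  | add_one α ih => rw [stage_succ]; exact hΦ _ ih
  | limit α hα ih =>
    rw [stage_limit hα]
    have : Nonempty (Set.Iio α) := ⟨⟨0, hα.bot_lt⟩⟩
    exact hU _ _ (fun β γ hβγ => stage_monotone h hβγ) fun β => ih β.1 β.2

end Iteration

/-! ### Closures under `Θ*` of a single sentence -/

section Closure

variable {A : Sentence L → Prop} {γ : Sentence L}

theorem stage_thetaWith_subset_apply (A : Sentence L → Prop) (γ : Sentence L) (α : Ordinal.{0}) :
    stage (thetaWith L A) {γ.code} α ⊆ thetaWith L A (stage (thetaWith L A) {γ.code} α) :=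
  subset_thetaWith A <| stage_subset (Set.singleton_subset_iff.2 (code_mem_Sent γ))
    (fun S _ => thetaWith_subset_Sent A S) α

theorem closureUnder_thetaWith (A : Sentence L → Prop) (γ : Sentence L) :
    closureUnder (thetaWith L A) {γ.code} =
      thetaWith L A (closureUnder (thetaWith L A) {γ.code}) :=
  closureUnder_eq_apply (stage_thetaWith_subset_apply A γ)

/-- The invariant `S ⊆ supTruths L (F S)` holds at every stage of the iteration, and therefore for the
closure. -/
theorem closureUnder_thetaWith_subset_supTruths {F : Set ℕ → Set (Set ℕ)} (hF : IsScheme L F)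
    (hA : ∀ ψ, A ψ → ∀ S, ∀ X ∈ F S, Models X ψ) (hγ : ∀ S, ∀ X ∈ F S, Models X γ) :
    closureUnder (thetaWith L A) {γ.code} ⊆
      supTruths L (F (closureUnder (thetaWith L A) {γ.code})) := by
  refine closureUnder_induction (P := fun S => S ⊆ supTruths L (F S))
    (stage_thetaWith_subset_apply A γ) ?_ (fun S hS => ?_) fun ι _ _ f _ hf => ?_
  · exact Set.singleton_subset_iff.2 (code_mem_supTruths.2 (hγ _))
  · have hS' : S ⊆ thetaWith L A S :=
      subset_thetaWith A (hS.trans (supTruths_subset_Sent _))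
    exact (thetaWith_subset_supTruths hF (fun ψ hψ => hA ψ hψ S) hS).trans
      (supTruths_anti (hF.anti hS'))
  · exact Set.iUnion_subset fun i => (hf i).trans
      (supTruths_anti (hF.anti (Set.subset_iUnion f i)))

end Closure

/-! ### Families of candidate interpretations -/

variable (L) in
/-- The family underlying `VB`, restricted to the sets with the property `E`. -/
def antiExtFamily (E : Set ℕ → Prop) (S : Set ℕ) : Set (Set ℕ) :=
  {X | X ⊆ Sent L ∧ S ⊆ X ∧ X ∩ antiExt L S = ∅ ∧ E X}

/-- The supersets of `S` with the property `K`. -/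
def supersetFamily (K : Set ℕ → Prop) (S : Set ℕ) : Set (Set ℕ) := {X | S ⊆ X ∧ K X}

theorem isScheme_antiExtFamily {E : Set ℕ → Prop} (hE : ∀ X, E X → E (theory L X)) :
    IsScheme L (antiExtFamily L E) where
  anti := by
    rintro S T hST X ⟨h₁, h₂, h₃, h₄⟩
    refine ⟨h₁, hST.trans h₂, ?_, h₄⟩
    rw [Set.eq_empty_iff_forall_notMem] at h₃ ⊢
    rintro n ⟨hn, h⟩
    exact h₃ n ⟨hn, h.imp (fun ⟨φ, hφ, hφS⟩ => ⟨φ, hφ, hST hφS⟩) id⟩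
  subset_Sent h := h.1
  subset h := h.2.1
  notMem := by
    rintro S X ⟨_, _, h, _⟩ φ hφ hφX
    exact Set.eq_empty_iff_forall_notMem.1 h _ ⟨hφX, Or.inl ⟨φ, rfl, hφ⟩⟩
  theory_mem := by
    intro S X hS hX
    have hSX := hS.trans (supTruths_subset_theory hX)
    refine ⟨theory_subset_Sent X, hSX, ?_, hE X hX.2.2.2⟩
    rw [Set.eq_empty_iff_forall_notMem]
    rintro n ⟨hn, ⟨φ, rfl, hφ⟩ | hn'⟩
    · exact CON_theory X ⟨φ, hn, hSX hφ⟩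
    · exact hn' (theory_subset_Sent X hn)

theorem isScheme_supersetFamily {K : Set ℕ → Prop} (hK : ∀ X, K X → X ⊆ Sent L ∧ CON L X)
    (hT : ∀ X, K X → K (theory L X)) : IsScheme L (supersetFamily K) where
  anti := fun _ _ hST _ h => ⟨hST.trans h.1, h.2⟩
  subset_Sent h := (hK _ h.2).1
  subset h := h.1
  notMem h φ hφ hφX := (hK _ h.2).2 ⟨φ, hφX, h.1 hφ⟩
  theory_mem hS hX := ⟨hS.trans (supTruths_subset_theory hX), hT _ hX.2⟩

theorem VB_eq (S : Set ℕ) : VB L S = supTruths L (antiExtFamily L (fun _ => True) S) := by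
  ext n
  simp only [VB, supTruths, antiExtFamily, Set.mem_ofPred_eq, and_true, and_imp]

theorem VC_eq (S : Set ℕ) :
    VC L S = supTruths L (supersetFamily (fun X => X ⊆ Sent L ∧ CON L X) S) := by
  ext n
  simp only [VC, supTruths, supersetFamily, Set.mem_ofPred_eq, and_imp]
  exact exists_congr fun φ => and_congr_right fun _ => forall_congr' fun X => forall_comm

theorem MC_eq (S : Set ℕ) :
    MC L S = supTruths L (supersetFamily (fun X => X ⊆ Sent L ∧ MXC L X) S) := by
  ext n
  simp only [MC, supTruths, supersetFamily, Set.mem_ofPred_eq, and_imp]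
  exact exists_congr fun φ => and_congr_right fun _ => forall_congr' fun X => forall_comm

theorem inter_antiExt_eq_empty {S : Set ℕ} (hS : S ⊆ Sent L) (hC : CON L S) :
    S ∩ antiExt L S = ∅ := by
  rw [Set.eq_empty_iff_forall_notMem]
  rintro _ ⟨hn, ⟨φ, rfl, hφ⟩ | hn'⟩
  exacts [hC ⟨φ, hn, hφ⟩, hn' (hS hn)]

/-! ### Supervaluational fixed points are fixed points of the operators -/

theorem supFixedPoints_VB_subset : SupFixedPoints L (VB L) ⊆ Z L := by
  rintro S ⟨hS, hC, hJ⟩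
  rw [VB_eq] at hJ
  have hF := isScheme_antiExtFamily (L := L) (E := fun _ => True) fun _ _ => trivial
  refine ⟨?_, classicallySound_of_subset_supTruths hJ.subset
    ⟨hS, subset_rfl, inter_antiExt_eq_empty hS hC, trivial⟩⟩
  rw [ThetaStar_eq]
  exact eq_thetaWith_of_eq_supTruths hF (fun _ h => h.elim) hJ

theorem supFixedPoints_VC_subset : SupFixedPoints L (VC L) ⊆ Zc L := by
  rintro S ⟨hS, hC, hJ⟩
  rw [VC_eq] at hJ
  have hF := isScheme_supersetFamily (L := L) (K := fun X => X ⊆ Sent L ∧ CON L X)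
    (fun _ h => h) fun X _ => ⟨theory_subset_Sent X, CON_theory X⟩
  exact ⟨eq_thetaWith_of_eq_supTruths hF (fun _ h X hX => h.models hX.2.1 hX.2.2) hJ,
    classicallySound_of_subset_supTruths hJ.subset ⟨subset_rfl, hS, hC⟩⟩

theorem supFixedPoints_MC_subset : SupFixedPoints L (MC L) ⊆ Zmc L := by
  rintro S ⟨hS, hC, hJ⟩
  rw [MC_eq] at hJ
  have hF := isScheme_supersetFamily (L := L) (K := fun X => X ⊆ Sent L ∧ MXC L X)
    (fun _ h => ⟨h.1, h.2.1⟩) fun X _ => ⟨theory_subset_Sent X, MXC_theory X⟩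
  exact ⟨eq_thetaWith_of_eq_supTruths hF (fun _ h X hX => h.models hX.2.2) hJ, hC⟩

/-! ### Maximal consistent extensions of closures -/

/-- The ultralimit of a family of sets: the `n` that belong to almost all of them. -/
def ultralimit {ι : Type*} (U : Ultrafilter ι) (X : ι → Set ℕ) : Set ℕ := {n | ∀ᶠ i in U, n ∈ X i}

/-- A class of maximal consistent sets closed under passing to theories and under ultralimits.
Closure under ultralimits is the compactness that carries the iteration through limit stages. -/
structure IsClosedClass (L : ArithLang) (K : Set ℕ → Prop) : Prop where
  subset_Sent : ∀ {X}, K X → X ⊆ Sent L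
  mxc : ∀ {X}, K X → MXC L X
  theory : ∀ {X}, K X → K (theory L X)
  ultralimit : ∀ {ι : Type 1} (U : Ultrafilter ι) (X : ι → Set ℕ), (∀ i, K (X i)) →
    K (ultralimit U X)

theorem ultralimit_subset_Sent {ι : Type*} (U : Ultrafilter ι) {X : ι → Set ℕ}
    (h : ∀ i, X i ⊆ Sent L) : ultralimit U X ⊆ Sent L := by
  intro n hn
  obtain ⟨i, hi⟩ := Filter.Eventually.exists hn
  exact h i hi

theorem MXC_ultralimit {ι : Type*} (U : Ultrafilter ι) {X : ι → Set ℕ} (h : ∀ i, MXC L (X i)) :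
    MXC L (ultralimit U X) := by
  constructor
  · rintro ⟨φ, h₁, h₂⟩
    obtain ⟨i, h₁, h₂⟩ := (Filter.Eventually.and h₁ h₂).exists
    exact (h i).1 ⟨φ, h₁, h₂⟩
  · intro φ hφ
    exact (Ultrafilter.eventually_not.2 hφ).mono fun i hi => (h i).2 φ hi

theorem IsClosedClass.isScheme {K : Set ℕ → Prop} (hK : IsClosedClass L K) :
    IsScheme L (supersetFamily K) :=
  isScheme_supersetFamily (fun _ h => ⟨hK.subset_Sent h, (hK.mxc h).1⟩) fun _ h => hK.theory h

/-- Compactness: the ultralimit, along the order, of extensions of the members of a chain extends the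
union of the chain. -/
theorem IsClosedClass.exists_superset_iUnion {K : Set ℕ → Prop} (hK : IsClosedClass L K)
    {ι : Type 1} [LinearOrder ι] [Nonempty ι] {f : ι → Set ℕ} (hf : Monotone f)
    (h : ∀ i, (supersetFamily K (f i)).Nonempty) : (supersetFamily K (⋃ i, f i)).Nonempty := by
  choose X hX using h
  refine ⟨SupTruth.ultralimit (Ultrafilter.of Filter.atTop) X, Set.iUnion_subset fun i n hn => ?_,
    hK.ultralimit _ X fun i => (hX i).2⟩
  exact Ultrafilter.of_le _ ((Filter.eventually_ge_atTop i).mono fun j hj => (hX j).1 (hf hj hn))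

/-- The closure of `γ` has an extension in `K`, provided that `γ` and the sentences `A` hold in all
members of `K`, and `K` is not empty. At successor stages an extension `X` is replaced by the theory
of `(ℕ, X)`; at limit stages an ultralimit is taken. -/
theorem IsClosedClass.closureUnder {K : Set ℕ → Prop} (hK : IsClosedClass L K)
    {A : Sentence L → Prop} {γ : Sentence L} (hA : ∀ ψ, A ψ → ∀ X, K X → Models X ψ)
    (hγ : ∀ X, K X → Models X γ) {X₀ : Set ℕ} (hX₀ : K X₀) :
    (supersetFamily K (closureUnder (thetaWith L A) {γ.code})).Nonempty := by
  have hF := hK.isScheme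
  refine (closureUnder_induction
    (P := fun S => S ⊆ supTruths L (supersetFamily K S) ∧ (supersetFamily K S).Nonempty)
    (stage_thetaWith_subset_apply A γ) ⟨?_, SupTruth.theory L X₀, ?_, hK.theory hX₀⟩ ?_ ?_).2
  · exact Set.singleton_subset_iff.2 (code_mem_supTruths.2 fun X hX => hγ X hX.2)
  · exact Set.singleton_subset_iff.2 (code_mem_theory.2 (hγ X₀ hX₀))
  · rintro S ⟨hS, X, hX⟩
    have hS' : S ⊆ thetaWith L A S :=
      subset_thetaWith A (hS.trans (supTruths_subset_Sent _))
    have hΘ := thetaWith_subset_supTruths hF (fun ψ hψ X hX => hA ψ hψ X hX.2) hS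
    exact ⟨hΘ.trans (supTruths_anti (hF.anti hS')), SupTruth.theory L X,
      hΘ.trans (supTruths_subset_theory hX), hK.theory hX.2⟩
  · intro ι _ _ f hf h
    exact ⟨Set.iUnion_subset fun i => (h i).1.trans
      (supTruths_anti (hF.anti (Set.subset_iUnion f i))),
      hK.exists_superset_iUnion hf fun i => (h i).2⟩

/-! ### Two truth-tellers -/

section TruthTellers

variable {τ₁ τ₂ : Sentence L} {A : Sentence L → Prop}

theorem isClosedClass_truthTellers (h₁ : IsTruthTeller τ₁) (h₂ : IsTruthTeller τ₂) :
    IsClosedClass L fun X => X ⊆ Sent L ∧ MXC L X ∧ τ₁.code ∈ X ∧ τ₂.code ∉ X where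
  subset_Sent h := h.1
  mxc h := h.2.1
  theory := by
    rintro X ⟨_, _, h₃, h₄⟩
    refine ⟨theory_subset_Sent X, MXC_theory X, ?_⟩
    rw [code_mem_theory, code_mem_theory, h₁.models_iff, h₂.models_iff]
    exact ⟨h₃, h₄⟩
  ultralimit U X h := ⟨ultralimit_subset_Sent U fun i => (h i).1,
    MXC_ultralimit U fun i => (h i).2.1, Filter.Eventually.of_forall fun i => (h i).2.2.1,
    Ultrafilter.eventually_not.1 (Filter.Eventually.of_forall fun i => (h i).2.2.2)⟩

/-- Nothing in the closure prevents one truth-teller from being true and the other false. -/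
theorem exists_MXC_superset_closure_truthTellers (h₁ : IsTruthTeller τ₁) (h₂ : IsTruthTeller τ₂)
    (hne : τ₁ ≠ τ₂) (hA : ∀ ψ, A ψ → ∀ X, X ⊆ Sent L → MXC L X → Models X ψ) {γ : Sentence L}
    (hγ : ∀ X, τ₂.code ∉ X → Models X γ) (hγ' : ∀ X, τ₁.code ∉ X → Models X γ) :
    (∃ X, closureUnder (thetaWith L A) {γ.code} ⊆ X ∧ MXC L X ∧ τ₁.code ∈ X ∧ τ₂.code ∉ X) ∧
    ∃ X, closureUnder (thetaWith L A) {γ.code} ⊆ X ∧ MXC L X ∧ τ₂.code ∈ X ∧ τ₁.code ∉ X := by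
  have key : ∀ {τ₁ τ₂ : Sentence L}, IsTruthTeller τ₁ → IsTruthTeller τ₂ → τ₁ ≠ τ₂ →
      (∀ X, τ₂.code ∉ X → Models X γ) →
      ∃ X, closureUnder (thetaWith L A) {γ.code} ⊆ X ∧ MXC L X ∧ τ₁.code ∈ X ∧ τ₂.code ∉ X := by
    intro τ₁ τ₂ h₁ h₂ hne hγ
    obtain ⟨X, hX, _, h⟩ := (isClosedClass_truthTellers h₁ h₂).closureUnder
      (fun ψ hψ X hX => hA ψ hψ X hX.1 hX.2.1) (fun X hX => hγ X hX.2.2.2)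
      (X₀ := theory L {τ₁.code}) (by
        refine ⟨theory_subset_Sent _, MXC_theory _, ?_⟩
        rw [code_mem_theory, code_mem_theory, h₁.models_iff, h₂.models_iff]
        exact ⟨rfl, fun h => hne (Fml.code_injective _ _ h).symm⟩)
    exact ⟨X, hX, h⟩
  exact ⟨key h₁ h₂ hne hγ, key h₂ h₁ hne.symm hγ'⟩

theorem models_or_neg_iff (h₁ : IsTruthTeller τ₁) (h₂ : IsTruthTeller τ₂) (X : Set ℕ) :
    Models X (Fml.or (.neg τ₁) (.neg τ₂)) ↔ ¬ (τ₁.code ∈ X ∧ τ₂.code ∈ X) := by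
  change (¬ Models X τ₁ ∨ ¬ Models X τ₂) ↔ _
  rw [h₁.models_iff, h₂.models_iff, not_and_or]

/-- The closure `Y` of `¬τ₁ ∨ ¬τ₂` is consistent, does not contain `τ₁`, and stays consistent when
both truth-tellers are added. The last is a matter of pairs of sentences only, so that it suffices
that each truth-teller belongs to some maximal consistent extension of `Y`. -/
theorem closure_truthTellers (h₁ : IsTruthTeller τ₁) (h₂ : IsTruthTeller τ₂) (hne : τ₁ ≠ τ₂)
    (hA : ∀ ψ, A ψ → ∀ X, X ⊆ Sent L → MXC L X → Models X ψ) {Y : Set ℕ}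
    (hY : Y = closureUnder (thetaWith L A) {(Fml.or (.neg τ₁) (.neg τ₂)).code}) :
    Y ⊆ Sent L ∧ CON L Y ∧ τ₁.code ∉ Y ∧ CON L (insert τ₁.code (insert τ₂.code Y)) := by
  obtain ⟨⟨X₁, hX₁, hM₁, h₁₁, h₁₂⟩, X₂, hX₂, hM₂, h₂₂, h₂₁⟩ :=
    exists_MXC_superset_closure_truthTellers (A := A) h₁ h₂ hne hA
      (γ := Fml.or (.neg τ₁) (.neg τ₂)) (fun X h => (models_or_neg_iff h₁ h₂ X).2 fun h' => h h'.2)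
      (fun X h => (models_or_neg_iff h₁ h₂ X).2 fun h' => h h'.1)
  rw [← hY] at hX₁ hX₂
  refine ⟨?_, hM₁.1.mono hX₁, fun h => h₂₁ (hX₂ h), ?_⟩
  · rw [hY, closureUnder_thetaWith]
    exact thetaWith_subset_Sent _ _
  -- Neither truth-teller is the negation of one, since all truth-tellers hold when every
  -- sentence counts as true.
  have tt : ∀ {τ τ' φ : Sentence L}, IsTruthTeller τ → IsTruthTeller τ' → φ.code = τ.code →
      φ.neg.code = τ'.code → False := by
    intro τ τ' φ h h' e e'
    obtain rfl := Fml.code_injective _ _ e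
    obtain rfl := Fml.code_injective _ _ e'
    exact (h'.models_iff Set.univ).2 trivial ((h.models_iff Set.univ).2 trivial)
  rintro ⟨φ, (h | h | h), (h' | h' | h')⟩
  · exact tt h₁ h₁ h h'
  · exact tt h₁ h₂ h h'
  · exact hM₁.1 ⟨φ, h ▸ h₁₁, hX₁ h'⟩
  · exact tt h₂ h₁ h h'
  · exact tt h₂ h₂ h h'
  · exact hM₂.1 ⟨φ, h ▸ h₂₂, hX₂ h'⟩
  · exact hM₁.1 ⟨φ, hX₁ h, h' ▸ h₁₁⟩
  · exact hM₂.1 ⟨φ, hX₂ h, h' ▸ h₂₂⟩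
  · exact hM₁.1 ⟨φ, hX₁ h, hX₁ h'⟩

theorem insert_insert_subset_Sent {Y : Set ℕ} (hY : Y ⊆ Sent L) (φ ψ : Sentence L) :
    insert φ.code (insert ψ.code Y) ⊆ Sent L :=
  Set.insert_subset (code_mem_Sent φ) (Set.insert_subset (code_mem_Sent ψ) hY)

/-- The closure `Y` is sound because its members hold in all admissible `X` that do not contain both
truth-tellers, `Y` being one of them. It is not a fixed point of `VB`, because adding both
truth-tellers to `Y` makes `¬τ₁ ∨ ¬τ₂` false. -/
theorem closure_truthTellers_VB (h₁ : IsTruthTeller τ₁) (h₂ : IsTruthTeller τ₂) (hne : τ₁ ≠ τ₂) :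
    closureUnder (ThetaStar L) {(Fml.or (.neg τ₁) (.neg τ₂)).code} ∈ Z L ∧
    closureUnder (ThetaStar L) {(Fml.or (.neg τ₁) (.neg τ₂)).code} ≠
      VB L (closureUnder (ThetaStar L) {(Fml.or (.neg τ₁) (.neg τ₂)).code}) := by
  rw [Z, Set.mem_ofPred_eq, ThetaStar_eq]
  obtain ⟨hS, hC, hτ, hC'⟩ := closure_truthTellers (A := fun _ => False) h₁ h₂ hne
    (fun _ h => h.elim) rfl
  refine ⟨⟨closureUnder_thetaWith _ _, ?_⟩, fun h => ?_⟩
  · have hF := isScheme_antiExtFamily (L := L) (E := fun X => ¬ (τ₁.code ∈ X ∧ τ₂.code ∈ X))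
      (fun X hX => by
        rwa [code_mem_theory, code_mem_theory, h₁.models_iff, h₂.models_iff])
    exact classicallySound_of_subset_supTruths
      (closureUnder_thetaWith_subset_supTruths hF (fun _ h => h.elim)
        fun S X hX => (models_or_neg_iff h₁ h₂ X).2 hX.2.2.2)
      ⟨hS, subset_rfl, inter_antiExt_eq_empty hS hC, fun h => hτ h.1⟩
  · have hγ := h.subset (subset_closureUnder rfl)
    rw [VB_eq, code_mem_supTruths] at hγ
    refine (models_or_neg_iff h₁ h₂ _).1 (hγ _ ⟨insert_insert_subset_Sent hS τ₁ τ₂,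
      (Set.subset_insert _ _).trans (Set.subset_insert _ _), ?_, trivial⟩)
      ⟨Set.mem_insert _ _, Set.mem_insert_of_mem _ (Set.mem_insert _ _)⟩
    rw [Set.eq_empty_iff_forall_notMem]
    rintro _ ⟨hn, ⟨φ, rfl, hφ⟩ | hn'⟩
    · exact hC' ⟨φ, hn, Set.mem_insert_of_mem _ (Set.mem_insert_of_mem _ hφ)⟩
    · exact hn' (insert_insert_subset_Sent hS τ₁ τ₂ hn)

theorem closure_truthTellers_VC (h₁ : IsTruthTeller τ₁) (h₂ : IsTruthTeller τ₂) (hne : τ₁ ≠ τ₂) :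
    closureUnder (ThetaStarC L) {(Fml.or (.neg τ₁) (.neg τ₂)).code} ∈ Zc L ∧
    closureUnder (ThetaStarC L) {(Fml.or (.neg τ₁) (.neg τ₂)).code} ≠
      VC L (closureUnder (ThetaStarC L) {(Fml.or (.neg τ₁) (.neg τ₂)).code}) := by
  change closureUnder (thetaWith L IsCon) _ ∈ _ ∧
    closureUnder (thetaWith L IsCon) _ ≠ VC L (closureUnder (thetaWith L IsCon) _)
  obtain ⟨hS, hC, hτ, hC'⟩ := closure_truthTellers (A := IsCon) h₁ h₂ hne
    (fun _ h X hX hM => h.models hX hM.1) rfl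
  refine ⟨⟨closureUnder_thetaWith _ _, ?_⟩, fun h => ?_⟩
  · have hF := isScheme_supersetFamily (L := L)
      (K := fun X => X ⊆ Sent L ∧ CON L X ∧ ¬ (τ₁.code ∈ X ∧ τ₂.code ∈ X))
      (fun X hX => ⟨hX.1, hX.2.1⟩) (fun X hX => by
        refine ⟨theory_subset_Sent X, CON_theory X, ?_⟩
        rw [code_mem_theory, code_mem_theory, h₁.models_iff, h₂.models_iff]
        exact hX.2.2)
    exact classicallySound_of_subset_supTruths
      (closureUnder_thetaWith_subset_supTruths hF (fun _ h S X hX => h.models hX.2.1 hX.2.2.1)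
        fun S X hX => (models_or_neg_iff h₁ h₂ X).2 hX.2.2.2)
      ⟨subset_rfl, hS, hC, fun h => hτ h.1⟩
  · have hγ := h.subset (subset_closureUnder rfl)
    rw [VC_eq, code_mem_supTruths] at hγ
    exact (models_or_neg_iff h₁ h₂ _).1
      (hγ _ ⟨(Set.subset_insert _ _).trans (Set.subset_insert _ _),
        insert_insert_subset_Sent hS τ₁ τ₂, hC'⟩)
      ⟨Set.mem_insert _ _, Set.mem_insert_of_mem _ (Set.mem_insert _ _)⟩

end TruthTellers

/-! ### Two Liars -/

/-- `φ` without its leading negations. -/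
def Fml.core : {n : ℕ} → Fml L n → Fml L n
  | _, .neg φ => φ.core
  | _, φ => φ

/-- Whether the number of leading negations of `φ` is odd. -/
def Fml.parity : {n : ℕ} → Fml L n → Bool
  | _, .neg φ => !φ.parity
  | _, _ => false

theorem Fml.sat_iff_core (X : Set ℕ) {n : ℕ} (φ : Fml L n) (e : Fin n → ℕ) :
    φ.Sat X e ↔ (φ.parity = false ↔ φ.core.Sat X e) := by
  induction φ with
  | neg φ ih =>
    rw [Fml.Sat, ih, Fml.core, Fml.parity]
    cases φ.parity <;> simp
  | _ => simp [Fml.core, Fml.parity]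

theorem models_iff_of_core_eq {φ ψ : Sentence L} (h : φ.core = ψ.core) (X : Set ℕ) :
    Models X φ ↔ (φ.parity = ψ.parity ↔ Models X ψ) := by
  rw [Models, Models, φ.sat_iff_core, ψ.sat_iff_core, h]
  cases φ.parity <;> cases ψ.parity <;> simp

open Classical in
/-- `X`, changed so that `l₁` becomes true and `l₂` false, and likewise for the sentences that
differ from one of them in the number of leading negations only. -/
def flipped (l₁ l₂ : Sentence L) (X : Set ℕ) (φ : Sentence L) : Prop :=
  if φ.core = l₁.core then φ.parity = l₁.parity
  else if φ.core = l₂.core then φ.parity ≠ l₂.parity else φ.code ∈ X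

theorem flipped_neg (l₁ l₂ : Sentence L) {X : Set ℕ} (hX : MXC L X) (φ : Sentence L) :
    flipped l₁ l₂ X φ.neg ↔ ¬ flipped l₁ l₂ X φ := by
  have h : φ.neg.code ∈ X ↔ φ.code ∉ X := ⟨fun h h' => hX.1 ⟨φ, h', h⟩, hX.2 φ⟩
  have hp : φ.neg.parity = !φ.parity := by rw [Fml.parity]
  have hc : φ.neg.core = φ.core := by rw [Fml.core]
  by_cases c₁ : φ.core = l₁.core
  · rw [flipped, flipped, if_pos c₁, if_pos (hc.trans c₁), hp]
    cases φ.parity <;> cases l₁.parity <;> simp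
  by_cases c₂ : φ.core = l₂.core
  · rw [flipped, flipped, if_neg c₁, if_pos c₂, if_neg (hc ▸ c₁), if_pos (hc.trans c₂), hp]
    cases φ.parity <;> cases l₂.parity <;> simp
  · rwa [flipped, flipped, if_neg c₁, if_neg c₂, if_neg (hc ▸ c₁), if_neg (hc ▸ c₂)]

section Liars

variable {l₁ l₂ : Sentence L}

theorem models_iff_liars (h₁ : IsLiar l₁) (h₂ : IsLiar l₂) (X : Set ℕ) :
    Models X (l₁.iff l₂) ↔ (l₁.code ∈ X ↔ l₂.code ∈ X) := by
  rw [models_iff, h₁.models_iff, h₂.models_iff, not_iff_not]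

theorem isClosedClass_liars (h₁ : IsLiar l₁) (h₂ : IsLiar l₂) :
    IsClosedClass L fun X => X ⊆ Sent L ∧ MXC L X ∧ (l₁.code ∈ X ↔ l₂.code ∈ X) where
  subset_Sent h := h.1
  mxc h := h.2.1
  theory := by
    rintro X ⟨_, _, h₃⟩
    refine ⟨theory_subset_Sent X, MXC_theory X, ?_⟩
    rw [code_mem_theory, code_mem_theory, h₁.models_iff, h₂.models_iff, h₃]
  ultralimit U X h := ⟨ultralimit_subset_Sent U fun i => (h i).1,
    MXC_ultralimit U fun i => (h i).2.1,
    Filter.eventually_congr (Filter.Eventually.of_forall fun i => (h i).2.2)⟩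

/-- Distinct Liars differ in more than their leading negations. Otherwise their truth values would
either agree in all interpretations or differ in all of them; but they agree when no sentence counts
as true, and differ when `l₁` is the only sentence that does. -/
theorem IsLiar.core_ne (h₁ : IsLiar l₁) (h₂ : IsLiar l₂) (hne : l₁ ≠ l₂) : l₂.core ≠ l₁.core := by
  intro h
  have h₀ := models_iff_of_core_eq h ∅
  have h₃ := models_iff_of_core_eq h {l₁.code}
  rw [h₁.models_iff, h₂.models_iff] at h₀ h₃
  have : l₂.code ∉ ({l₁.code} : Set ℕ) := fun h => hne (Fml.code_injective _ _ h).symm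
  simp_all

/-- The closure `Y` is consistent because it has a maximal consistent extension `X` that contains both
Liars or neither. As `Y` decides neither Liar, `X` may be changed into a maximal consistent extension
of `Y` that contains `l₁` but not `l₂`, in which `l₁ ↔ l₂` is false; so `Y` is not a fixed point of
`MC`. -/
theorem closure_liars_MC (h₁ : IsLiar l₁) (h₂ : IsLiar l₂) (hne : l₁ ≠ l₂) :
    closureUnder (ThetaStarMC L) {(Fml.iff l₁ l₂).code} ∈ Zmc L ∧
    closureUnder (ThetaStarMC L) {(Fml.iff l₁ l₂).code} ≠
      MC L (closureUnder (ThetaStarMC L) {(Fml.iff l₁ l₂).code}) := by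
  change closureUnder (thetaWith L IsCom) _ ∈ _ ∧
    closureUnder (thetaWith L IsCom) _ ≠ MC L (closureUnder (thetaWith L IsCom) _)
  have hK := isClosedClass_liars h₁ h₂
  obtain ⟨X, hYX, hX⟩ := hK.closureUnder (A := IsCom) (γ := l₁.iff l₂) (X₀ := theory L ∅)
    (fun ψ hψ X hX => hψ.models hX.2.1) (fun X hX => (models_iff_liars h₁ h₂ X).2 hX.2.2) (by
      refine ⟨theory_subset_Sent _, MXC_theory _, ?_⟩
      rw [code_mem_theory, code_mem_theory, h₁.models_iff, h₂.models_iff]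
      rfl)
  have hY := closureUnder_thetaWith_subset_supTruths hK.isScheme (A := IsCom) (γ := l₁.iff l₂)
    (fun ψ hψ S X hX => hψ.models hX.2.2.1) fun S X hX => (models_iff_liars h₁ h₂ X).2 hX.2.2.2
  refine ⟨⟨closureUnder_thetaWith _ _, hX.2.1.1.mono hYX⟩, fun h => ?_⟩
  have hγ : (l₁.iff l₂).code ∈ closureUnder (thetaWith L IsCom) {(l₁.iff l₂).code} :=
    subset_closureUnder rfl
  generalize closureUnder (thetaWith L IsCom) {(l₁.iff l₂).code} = Y at hYX hY h hγ
  -- `Y` contains no sentence that differs from a Liar `l` in leading negations only: such a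
  -- sentence would hold both in `X` and in the theory of `(ℕ, X)`, on which `l` takes opposite
  -- values.
  have hcore : ∀ {l : Sentence L}, IsLiar l → ∀ φ : Sentence L, φ.code ∈ Y → φ.core ≠ l.core := by
    intro l hl φ hφ he
    have hφY := code_mem_supTruths.1 (hY hφ)
    have e₁ := models_iff_of_core_eq he X
    have e₂ := models_iff_of_core_eq he (theory L X)
    have e₃ := hl.models_iff (theory L X)
    rw [code_mem_theory] at e₃
    have m₁ := hφY X ⟨hYX, hX⟩
    have m₂ := hφY (theory L X) (hK.isScheme.theory_mem hY ⟨hYX, hX⟩)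
    tauto
  have hX' : ∀ φ : Sentence L, φ.code ∈ {n | ∃ φ : Sentence L, φ.code = n ∧ flipped l₁ l₂ X φ} ↔
      flipped l₁ l₂ X φ := by
    refine fun φ => ⟨?_, fun h => ⟨φ, rfl, h⟩⟩
    rintro ⟨ψ, h, hψ⟩
    rwa [← Fml.code_injective _ _ h]
  rw [h, MC_eq, code_mem_supTruths] at hγ
  have := (models_iff_liars h₁ h₂ _).1
    (hγ {n | ∃ φ : Sentence L, φ.code = n ∧ flipped l₁ l₂ X φ} ⟨?_, ?_, ?_, ?_⟩)
  · rw [hX', hX'] at this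
    simp [flipped, h₁.core_ne h₂ hne] at this
  · intro n hn
    obtain ⟨φ, rfl⟩ := hX.1 (hYX hn)
    rw [hX', flipped, if_neg (hcore h₁ φ hn), if_neg (hcore h₂ φ hn)]
    exact hYX hn
  · rintro _ ⟨φ, rfl, _⟩
    exact code_mem_Sent φ
  · rintro ⟨φ, hφ, hφ'⟩
    rw [hX'] at hφ hφ'
    exact (flipped_neg l₁ l₂ hX.2.1 φ).1 hφ' hφ
  · intro φ hφ
    rw [hX'] at hφ ⊢
    exact (flipped_neg l₁ l₂ hX.2.1 φ).2 hφ

end Liars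

end SupTruth

theorem mainTheorem10 (L : ArithLang) :
    -- there are two distinct truth-tellers, and two distinct Liars
    (∃ τ₁ τ₂ : Sentence L, IsTruthTeller τ₁ ∧ IsTruthTeller τ₂ ∧ τ₁ ≠ τ₂) ∧
    (∃ l₁ l₂ : Sentence L, IsLiar l₁ ∧ IsLiar l₂ ∧ l₁ ≠ l₂) ∧
    -- VB
    SupFixedPoints L (VB L) ⊆ Z L ∧
    Z L ≠ SupFixedPoints L (VB L) ∧
    (∀ τ₁ τ₂ : Sentence L, IsTruthTeller τ₁ → IsTruthTeller τ₂ → τ₁ ≠ τ₂ →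
      closureUnder (ThetaStar L) {(Fml.or (.neg τ₁) (.neg τ₂)).code} ∈ Z L ∧
      closureUnder (ThetaStar L) {(Fml.or (.neg τ₁) (.neg τ₂)).code} ≠
        VB L (closureUnder (ThetaStar L) {(Fml.or (.neg τ₁) (.neg τ₂)).code})) ∧
    -- VC
    SupFixedPoints L (VC L) ⊆ Zc L ∧
    Zc L ≠ SupFixedPoints L (VC L) ∧
    (∀ τ₁ τ₂ : Sentence L, IsTruthTeller τ₁ → IsTruthTeller τ₂ → τ₁ ≠ τ₂ →
      closureUnder (ThetaStarC L) {(Fml.or (.neg τ₁) (.neg τ₂)).code} ∈ Zc L ∧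
      closureUnder (ThetaStarC L) {(Fml.or (.neg τ₁) (.neg τ₂)).code} ≠
        VC L (closureUnder (ThetaStarC L) {(Fml.or (.neg τ₁) (.neg τ₂)).code})) ∧
    -- MC
    SupFixedPoints L (MC L) ⊆ Zmc L ∧
    Zmc L ≠ SupFixedPoints L (MC L) ∧
    (∀ l₁ l₂ : Sentence L, IsLiar l₁ → IsLiar l₂ → l₁ ≠ l₂ →
      closureUnder (ThetaStarMC L) {(Fml.iff l₁ l₂).code} ∈ Zmc L ∧
      closureUnder (ThetaStarMC L) {(Fml.iff l₁ l₂).code} ≠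
        MC L (closureUnder (ThetaStarMC L) {(Fml.iff l₁ l₂).code})) := by
  obtain ⟨τ₁, τ₂, hτ₁, hτ₂, hτ⟩ := exists_isTruthTeller_ne (L := L)
  obtain ⟨l₁, l₂, hl₁, hl₂, hl⟩ := exists_isLiar_ne (L := L)
  have hB := closure_truthTellers_VB hτ₁ hτ₂ hτ
  have hC := closure_truthTellers_VC hτ₁ hτ₂ hτ
  have hM := closure_liars_MC hl₁ hl₂ hl
  exact ⟨⟨τ₁, τ₂, hτ₁, hτ₂, hτ⟩, ⟨l₁, l₂, hl₁, hl₂, hl⟩,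
    supFixedPoints_VB_subset, fun h => hB.2 (h.subset hB.1).2.2,
    fun _ _ => closure_truthTellers_VB,
    supFixedPoints_VC_subset, fun h => hC.2 (h.subset hC.1).2.2,
    fun _ _ => closure_truthTellers_VC,
    supFixedPoints_MC_subset, fun h => hM.2 (h.subset hM.1).2.2,
    fun _ _ => closure_liars_MC⟩
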